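/- Let $\mathcal X,\mathcal Y$ be complete separable geodesic metric spaces and let $\mathcal C^x,\mathcal C^y:\mathcal X\times\mathcal Y\to\mathbb R$. **Notation.** A curve $z:[a,b]\to Z$ in a metric space is absolutely continuous if there is $f\in L^1(a,b)$ with $d(z_s,z_t)\le\int_s^t f(r)\,dr$ for all $a\le s<t\le b$; its metric derivative $|z'_t|=\lim_{h\to0}d(z_{t+h},z_t)/|h|$ then exists for a.e. $t$. For a function $F$ on a metric space, the slope is $|\nabla F|(x)=\limsup_{u\to x}\frac{(F(x)-F(u))^+}{d(x,u)}\in[0,\infty]$ (and $0$ at an isolated point). We write $|\nabla_1\mathcal C^x|(x,y)$ for the slope of $\mathcal C^x(\cdot,y)$ at $x$ and $|\nabla_2\mathcal C^y|(x,y)$ for the slope of $\mathcal C^y(x,\cdot)$ at $y$. For a curve $z=(x_t,y_t)$ and a division $\Delta=\{a=t_0<\dots<t_N=b\}$ with mesh $|\Delta|$, put $$\Upsilon(\Delta;z,a,b)=\sum_k\big[\mathcal C^x(x_{t_{k+1}},y_{t_k})-\mathcal C^x(x_{t_k},y_{t_k})\big]+\sum_k\big[\mathcal C^y(x_{t_k},y_{t_{k+1}})-\mathcal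 C^y(x_{t_k},y_{t_k})\big],\qquad \Upsilon(z,a,b)=\liminf_{|\Delta|\to0}\Upsilon(\Delta;z,a,b).$$ For $\tau>0$ let $\mathcal M^x(x,y,\tau)=\arg\min_{u\in\mathcal X}\frac{d(u,x)^2}{2\tau}+\mathcal C^x(u,y)$ and $\mathcal M^y(x,y,\tau)=\arg\min_{v\in\mathcal Y}\frac{d(v,y)^2}{2\tau}+\mathcal C^y(x,v)$. **Assumptions.** - (A1) $\mathcal C^x,\mathcal C^y\ge -C_1$ for some $C_1<\infty$. - (A2) There is $\bar\tau>0$ such that $\mathcal M^x(x,y,\tau)$ and $\mathcal M^y(x,y,\tau)$ are nonempty for all $0<\tau\le\bar\tau$ and all $(x,y)$. - (A3) For all $c\in\mathbb R$, $r>0$ and $(x,y)$ the sets $\{u\in\mathcal X:\mathcal C^x(u,y)\le c,\ d(u,x)\le r\}$ and $\{v\in\mathcal Y:\mathcal C^y(x,v)\le c,\ d(v,y)\le r\}$ are compact. - (A4) $|\nabla_1\mathcal C^x|$ and $|\nabla_2\mathcal C^y|$ are lower semicontinuous on $\mathcal X\times\mathcal Y$. - (A5) $\mathcal C^x$ is Lipschitz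 in its second argument and $\mathcal C^y$ is Lipschitz in its first argument, uniformly in the other variable. - (A6) For every absolutely continuous curve $z$ on $[a,b]$, $\Upsilon(z,a,b)\le\liminf_n\Upsilon(\Delta_n;z_n,a,b)$ whenever $\Delta_n$ are divisions of $[a,b]$ with $|\Delta_n|\to0$ and $z_n=(x_n,y_n)$ are absolutely continuous curves on $[a,b]$ with $z_n\to z$ uniformly and $\sup_n\int_a^b(|x_n'|+|y_n'|)\,dt<\infty$. **Interpolated curves.** Fix $(\bar x,\bar y)\in\mathcal X\times\mathcal Y$ and $T>0$. For $0<\tau\le\bar\tau$, an interpolated discrete curve of step $\tau$ is any $(x^\tau_t,y^\tau_t)_{t\ge0}$ with $(x^\tau_0,y^\tau_0)=(\bar x,\bar y)$ and, for all $k\ge0$ and $t\in(k\tau,(k+1)\tau]$, $$x^\tau_t\in\mathcal M^x(x^\tau_{k\tau},y^\tau_{k\tau},t-k\tau),\qquad y^\tau_t\in\mathcal M^y(x^\tau_{(k+1)\tau},y^\tau_{k\tau},t-k\tau).$$ **Theorem.** Assume (A1)–(A6). 1. There is a compact set $K\subset\mathcal X\times\mathcal Y$ such that all interpolated discrete curves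 with steps $0<\tau\le\bar\tau$ take their values in $K$ for $t\in[0,T]$. The interpolated discrete curves are relatively compact for uniform convergence on $[0,T]$ as $\tau\to0$: for every sequence of steps $0<\tau_n\le\bar\tau$ with $\tau_n\to0$, every sequence of interpolated discrete curves with steps $\tau_n$ has a subsequence that converges uniformly on $[0,T]$. 2. Every uniform limit $z=(x_t,y_t)_{t\in[0,T]}$ of interpolated discrete curves with steps $\tau_n\to0$ is an EDI equilibrium flow starting from $(\bar x,\bar y)$. That is, $z$ is absolutely continuous on $[0,T]$, $\lim_{t\to0^+}(x_t,y_t)=(\bar x,\bar y)$, and the inequality $$\Upsilon(z,t,s)+\frac12\int_t^s\big(|x_r'|^2+|y_r'|^2\big)dr+\frac12\int_t^s\big(|\nabla_1\mathcal C^x|^2(x_r,y_r)+|\nabla_2\mathcal C^y|^2(x_r,y_r)\big)dr\le0$$ holds for $t=0$ and all $s\in[0,T]$, and for a.e. $t\in(0,T]$ and all $s\in[t,T]$. -/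

import Mathlib

open Set Filter Topology MeasureTheory
open scoped ENNReal NNReal

/-- Any two points are joined by a constant-speed minimizing geodesic. -/
def IsGeodesicSpace (X : Type*) [MetricSpace X] : Prop :=
  ∀ x y : X, ∃ γ : ℝ → X, γ 0 = x ∧ γ 1 = y ∧
    ∀ s ∈ Icc (0 : ℝ) 1, ∀ t ∈ Icc (0 : ℝ) 1, dist (γ s) (γ t) = |s - t| * dist x y

/-- Absolute continuity on `[a, b]` of a curve in a metric space: the distance is controlled by
the integral of an `L¹` function. Values outside `[a, b]` are irrelevant. -/
def IsACCurve {Z : Type*} [MetricSpace Z] (z : ℝ → Z) (a b : ℝ) : Prop :=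
  ∃ f : ℝ → ℝ, IntegrableOn f (Icc a b) ∧
    ∀ s t : ℝ, a ≤ s → s < t → t ≤ b → dist (z s) (z t) ≤ ∫ r in s..t, f r

/-- The metric derivative `lim_{h → 0} d(z(t+h), z(t)) / |h|`. It is written as a `limsup`, which
makes it a total function; for an absolutely continuous curve the limit exists at almost every
`t`, and there the two agree. -/
noncomputable def metricDeriv {Z : Type*} [MetricSpace Z] (z : ℝ → Z) (t : ℝ) : ℝ≥0∞ :=
  limsup (fun h : ℝ => edist (z (t + h)) (z t) / ENNReal.ofReal |h|) (𝓝[≠] 0)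

/-- The (descending) slope `limsup_{u → x} (F x - F u)⁺ / d(x, u)`, with values in `[0, ∞]`;
it is `0` at an isolated point. -/
noncomputable def metricSlope {Z : Type*} [MetricSpace Z] (F : Z → ℝ) (x : Z) : ℝ≥0∞ :=
  limsup (fun u : Z => ENNReal.ofReal (F x - F u) / edist x u) (𝓝[≠] x)

/-- A division `a = t 0 < t 1 < ⋯ < t n = b` (the values `t k` with `k > n` play no role). -/
structure Division (a b : ℝ) where
  n : ℕ
  t : ℕ → ℝ
  left : t 0 = a
  right : t n = b
  lt : ∀ k < n, t k < t (k + 1)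

/-- The mesh `max_k (t (k+1) - t k)`. -/
noncomputable def Division.mesh {a b : ℝ} (Δ : Division a b) : ℝ≥0 :=
  (Finset.range Δ.n).sup fun k => Real.toNNReal (Δ.t (k + 1) - Δ.t k)

section Flow

variable {X Y : Type*} [MetricSpace X] [MetricSpace Y]

/-- `Υ(Δ; z)`: the variation of `Cx` in its first argument plus the variation of `Cy` in its
second argument along `z`, the other argument being frozen at the left end of each step. -/
noncomputable def upsilonDiv (Cx Cy : X → Y → ℝ) {a b : ℝ} (Δ : Division a b)
    (z : ℝ → X × Y) : ℝ :=
  (∑ k ∈ Finset.range Δ.n,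
      (Cx (z (Δ.t (k + 1))).1 (z (Δ.t k)).2 - Cx (z (Δ.t k)).1 (z (Δ.t k)).2)) +
    ∑ k ∈ Finset.range Δ.n,
      (Cy (z (Δ.t k)).1 (z (Δ.t (k + 1))).2 - Cy (z (Δ.t k)).1 (z (Δ.t k)).2)

/-- `Υ(z, a, b)`: the lower limit of `Υ(Δ; z)` as the mesh of the division `Δ` of `[a, b]` tends
to zero. -/
noncomputable def upsilon (Cx Cy : X → Y → ℝ) (z : ℝ → X × Y) (a b : ℝ) : EReal :=
  liminf (fun Δ : Division a b => (upsilonDiv Cx Cy Δ z : EReal))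
    (comap Division.mesh (𝓝 0))

/-- Half of the integral over `[a, b]` of the squared metric derivatives and the squared slopes
along the curve `z = (x, y)`. -/
noncomputable def dissipation (Cx Cy : X → Y → ℝ) (z : ℝ → X × Y) (a b : ℝ) : ℝ≥0∞ :=
  (1 / 2) * (∫⁻ r in Icc a b,
      (metricDeriv (fun t => (z t).1) r ^ 2 + metricDeriv (fun t => (z t).2) r ^ 2)) +
    (1 / 2) * (∫⁻ r in Icc a b,
      (metricSlope (fun u => Cx u (z r).2) (z r).1 ^ 2 +
        metricSlope (fun v => Cy (z r).1 v) (z r).2 ^ 2))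

/-- EDI equilibrium flows on `[0, T]` starting from `(x₀, y₀)`. When `Cx` and `Cy` are bounded
below and Lipschitz in the frozen variable, `Υ` is never `-∞` along an absolutely continuous
curve, so that the inequalities contain the finiteness of the dissipation. -/
structure IsEDIFlow (Cx Cy : X → Y → ℝ) (T : ℝ) (x₀ : X) (y₀ : Y) (z : ℝ → X × Y) : Prop where
  ac : IsACCurve z 0 T
  start : Tendsto z (𝓝[>] 0) (𝓝 (x₀, y₀))
  edi_zero : ∀ s ∈ Icc 0 T, upsilon Cx Cy z 0 s + (dissipation Cx Cy z 0 s : EReal) ≤ 0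
  edi_ae : ∀ᵐ t ∂(volume.restrict (Ioc 0 T)), ∀ s ∈ Icc t T,
    upsilon Cx Cy z t s + (dissipation Cx Cy z t s : EReal) ≤ 0

/-- `argmin_u d(u, x)² / (2 τ) + F u`. -/
def proxSet {Z : Type*} [MetricSpace Z] (F : Z → ℝ) (x : Z) (τ : ℝ) : Set Z :=
  {u | ∀ v, dist u x ^ 2 / (2 * τ) + F u ≤ dist v x ^ 2 / (2 * τ) + F v}

/-- `z : [0, ∞) → X × Y` is a discrete curve of the alternating scheme with step `τ`, interpolated
à la de Giorgi: for `t ∈ (kτ, (k+1)τ]`, `x_t` is a minimizer with parameter `t - kτ` started at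
`x_{kτ}`, with `y_{kτ}` frozen, and `y_t` is one started at `y_{kτ}`, with `x_{(k+1)τ}` frozen. -/
structure IsDeGiorgiCurve (Cx Cy : X → Y → ℝ) (x₀ : X) (y₀ : Y) (τ : ℝ)
    (z : ℝ → X × Y) : Prop where
  start : z 0 = (x₀, y₀)
  step_x : ∀ k : ℕ, ∀ t ∈ Ioc (k * τ) ((k + 1) * τ),
    (z t).1 ∈ proxSet (fun u => Cx u (z (k * τ)).2) (z (k * τ)).1 (t - k * τ)
  step_y : ∀ k : ℕ, ∀ t ∈ Ioc (k * τ) ((k + 1) * τ),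
    (z t).2 ∈ proxSet (fun v => Cy (z ((k + 1) * τ)).1 v) (z (k * τ)).2 (t - k * τ)

/-- Lower semicontinuity of `Υ`: along absolutely continuous curves `zs n` on `[a, b]` with
bounded lengths, converging uniformly to an absolutely continuous `z`, and divisions with mesh
tending to zero. -/
def UpsilonLSC (Cx Cy : X → Y → ℝ) : Prop :=
  ∀ (a b : ℝ), a ≤ b → ∀ z : ℝ → X × Y, IsACCurve z a b →
    ∀ (Δ : ℕ → Division a b) (zs : ℕ → ℝ → X × Y),
      Tendsto (fun n => (Δ n).mesh) atTop (𝓝 0) →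
      (∀ n, IsACCurve (zs n) a b) →
      TendstoUniformlyOn zs z atTop (Icc a b) →
      (⨆ n, ∫⁻ t in Icc a b,
        (metricDeriv (fun r => (zs n r).1) t + metricDeriv (fun r => (zs n r).2) t)) < ⊤ →
      upsilon Cx Cy z a b ≤ liminf (fun n => (upsilonDiv Cx Cy (Δ n) (zs n) : EReal)) atTop

end Flow

/-! The method is De Giorgi's minimizing movements, adapted to alternating steps. For one step from
x, the value min_u d(u,x)²/(2r) + F(u) decreases in r at rate at least d(u_r,x)²/(2r²) where it is
differentiable, and the slope of F at u_r is at most d(u_r,x)/r (`proxSet_deGiorgi`,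
`metricSlope_le_of_mem_proxSet`). Integrating over a step and summing gives the discrete inequality
½∑d²/τ + ½∫(quotients)² ≤ −U, where U adds the increments of Cx and Cy produced by the alternating
steps.

Each term passes to the limit separately. For the kinetic term, the lower limit of the partial
energy sums is a monotone function e with d(z_s,z_t)² ≤ (t−s)(e_t−e_s) (`StepBound.exists_energy`,
one such e for each coordinate); this single inequality yields both absolute continuity and |z'|² ≤
e' almost everywhere. The slopes pass by Fatou's lemma and their lower semicontinuity. For Υ there
is a mismatch: the y-step sees x already moved, whereas Υ freezes both arguments at the left end.
The nodes are therefore joined by a geodesic staircase in which x moves during one half step and y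
during the next; along it Υ equals U exactly (`sum_staircase`), and `UpsilonLSC` applies.

Compactness is not immediate, because Cx + Cy need not decrease: moving one variable changes the
other player's cost. The Lipschitz bounds and Young's inequality absorb these cross terms into half
of the dissipation (`IsDeGiorgiCurve.energy_le`). What remains is ∑d² = O(τ), hence a Hölder-½
modulus up to an error of order τ, and bounded costs, hence a common compact set; an Arzelà–Ascoli
argument for discontinuous curves concludes. -/

/-! ### Monotone functions as energy bounds -/

theorem MonotoneOn.lintegral_le_of_hasDerivAt {e : ℝ → ℝ} {a b : ℝ} (hab : a ≤ b)
    (he : MonotoneOn e (Icc a b)) (G : ℝ → ℝ≥0∞)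
    (hG : ∀ r ∈ Ioo a b, ∀ e', HasDerivAt e e' r → G r ≤ ENNReal.ofReal e') :
    ∫⁻ r in Icc a b, G r ≤ ENNReal.ofReal (e b - e a) := by
  have hint := MonotoneOn.intervalIntegrable_deriv (a := a) (b := b) (by rwa [uIcc_of_le hab])
  -- A monotone function may have jumps or a singular part, so the integral of its derivative is
  -- only bounded by its increment; this direction is the one needed. `G` need not be measurable.
  have hmem := MonotoneOn.intervalIntegral_deriv_mem_uIcc (a := a) (b := b)
    (by rwa [uIcc_of_le hab])
  have hle : e a ≤ e b := he (left_mem_Icc.2 hab) (right_mem_Icc.2 hab) hab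
  rw [uIcc_of_le (sub_nonneg.2 hle)] at hmem
  rw [Measure.restrict_congr_set (Ioo_ae_eq_Icc (μ := volume) (a := a) (b := b)).symm]
  have hder : ∀ᵐ r ∂volume.restrict (Ioo a b), HasDerivAt e (deriv e r) r := by
    rw [ae_restrict_iff' measurableSet_Ioo]
    filter_upwards [he.ae_differentiableWithinAt_of_mem] with r hr hr'
    exact ((hr (Ioo_subset_Icc_self hr')).differentiableAt (Icc_mem_nhds hr'.1 hr'.2)).hasDerivAt
  have hnn : ∀ r ∈ Ioo a b, 0 ≤ deriv e r := by
    intro r hr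
    have : derivWithin e (Icc a b) r = deriv e r :=
      derivWithin_of_mem_nhds (Icc_mem_nhds hr.1 hr.2)
    rw [← this]
    exact he.derivWithin_nonneg
  have hio : IntegrableOn (deriv e) (Ioo a b) :=
    ((intervalIntegrable_iff_integrableOn_Ioc_of_le hab).1 hint).mono_set Ioo_subset_Ioc_self
  calc ∫⁻ r in Ioo a b, G r ≤ ∫⁻ r in Ioo a b, ENNReal.ofReal (deriv e r) := by
        refine lintegral_mono_ae ?_
        filter_upwards [hder, ae_restrict_mem measurableSet_Ioo] with r h1 h2
        exact hG r h2 _ h1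
    _ = ENNReal.ofReal (∫ r in Ioo a b, deriv e r) := by
        rw [ofReal_integral_eq_lintegral_ofReal hio]
        filter_upwards [ae_restrict_mem measurableSet_Ioo] with r h2 using hnn r h2
    _ ≤ _ := by
        refine ENNReal.ofReal_le_ofReal ?_
        rw [intervalIntegral.integral_of_le hab, integral_Ioc_eq_integral_Ioo] at hmem
        exact hmem.2

/-- The intervals (e(l i), e(r i)] are again disjoint and lie in (e a, e b], so their lengths can be
compared through Lebesgue measure. -/
theorem MonotoneOn.sum_sub_le_of_pairwiseDisjoint {e : ℝ → ℝ} {a b : ℝ}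
    (he : MonotoneOn e (Icc a b)) {ι : Type*} (s : Finset ι) (l r : ι → ℝ)
    (hl : ∀ i ∈ s, l i ∈ Icc a b) (hr : ∀ i ∈ s, r i ∈ Icc a b) (hlr : ∀ i ∈ s, l i ≤ r i)
    (hd : (s : Set ι).PairwiseDisjoint fun i => Ioc (l i) (r i)) (hab : a ≤ b) :
    ∑ i ∈ s, (e (r i) - e (l i)) ≤ e b - e a := by
  have hle : e a ≤ e b := he (left_mem_Icc.2 hab) (right_mem_Icc.2 hab) hab
  have hd' : (s : Set ι).PairwiseDisjoint fun i => Ioc (e (l i)) (e (r i)) := by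
    intro i hi j hj hij
    have h := hd hi hj hij
    simp only [Function.onFun, Set.disjoint_left, mem_Ioc] at h ⊢
    rintro y ⟨h1, h2⟩ ⟨h3, h4⟩
    have hi' : l i < r i := lt_of_le_of_ne (hlr i hi) (fun h => by rw [h] at h1; linarith)
    have hj' : l j < r j := lt_of_le_of_ne (hlr j hj) (fun h => by rw [h] at h3; linarith)
    rcases le_or_gt (r i) (r j) with hc | hc
    · have : r i ≤ l j := by
        by_contra hcon
        exact h ⟨hi', le_rfl⟩ ⟨not_le.1 hcon, hc⟩
      have := he (hr i hi) (hl j hj) this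
      linarith
    · have : r j ≤ l i := by
        by_contra hcon
        exact h ⟨not_le.1 hcon, hc.le⟩ ⟨hj', le_rfl⟩
      have := he (hr j hj) (hl i hi) this
      linarith
  have hnn : ∀ i ∈ s, 0 ≤ e (r i) - e (l i) := fun i hi =>
    sub_nonneg.2 (he (hl i hi) (hr i hi) (hlr i hi))
  rw [← ENNReal.ofReal_le_ofReal_iff (sub_nonneg.2 hle), ENNReal.ofReal_sum_of_nonneg hnn]
  calc ∑ i ∈ s, ENNReal.ofReal (e (r i) - e (l i))
      = ∑ i ∈ s, volume (Ioc (e (l i)) (e (r i))) := by simp [Real.volume_Ioc]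
    _ = volume (⋃ i ∈ s, Ioc (e (l i)) (e (r i))) :=
        (measure_biUnion_finset hd' fun _ _ => measurableSet_Ioc).symm
    _ ≤ volume (Ioc (e a) (e b)) := by
        refine measure_mono (iUnion₂_subset fun i hi => Ioc_subset_Ioc ?_ ?_)
        · exact he (left_mem_Icc.2 hab) (hl i hi) (hl i hi).1
        · exact he (hr i hi) (right_mem_Icc.2 hab) (hr i hi).2
    _ = _ := Real.volume_Ioc

/-- Cauchy–Schwarz over disjoint intervals: the squared sum of distances is at most the total length
times the total increment of `e`. -/
theorem absolutelyContinuousOnInterval_of_sq_dist_le {Z : Type*} [PseudoMetricSpace Z]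
    {z : ℝ → Z} {e : ℝ → ℝ} {a b : ℝ} (hab : a ≤ b) (he : MonotoneOn e (Icc a b))
    (hz : ∀ s ∈ Icc a b, ∀ t ∈ Icc a b, s ≤ t →
      dist (z s) (z t) ^ 2 ≤ (t - s) * (e t - e s)) :
    AbsolutelyContinuousOnInterval z a b := by
  have hle : e a ≤ e b := he (left_mem_Icc.2 hab) (right_mem_Icc.2 hab) hab
  rw [absolutelyContinuousOnInterval_iff]
  intro ε hε
  -- The `+ 1` keeps the denominator positive when `e` is constant.
  refine ⟨ε ^ 2 / (e b - e a + 1), by have := sub_nonneg.2 hle; positivity, ?_⟩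
  rintro ⟨n, I⟩ hI hlt
  simp only at hlt ⊢
  have hI1 : ∀ i ∈ Finset.range n, (I i).1 ∈ Icc a b ∧ (I i).2 ∈ Icc a b := by
    have := hI.1; rw [uIcc_of_le hab] at this; exact this
  have hI2 := hI.2
  set l : ℕ → ℝ := fun i => min (I i).1 (I i).2
  set r : ℕ → ℝ := fun i => max (I i).1 (I i).2
  have hl : ∀ i ∈ Finset.range n, l i ∈ Icc a b := fun i hi =>
    ⟨le_min (hI1 i hi).1.1 (hI1 i hi).2.1, (min_le_left _ _).trans (hI1 i hi).1.2⟩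
  have hr : ∀ i ∈ Finset.range n, r i ∈ Icc a b := fun i hi =>
    ⟨(hI1 i hi).1.1.trans (le_max_left _ _), max_le (hI1 i hi).1.2 (hI1 i hi).2.2⟩
  have hlr : ∀ i ∈ Finset.range n, l i ≤ r i := fun i _ => min_le_max
  have hsum := he.sum_sub_le_of_pairwiseDisjoint (Finset.range n) l r hl hr hlr hI2 hab
  have hdist : ∀ i ∈ Finset.range n,
      dist (z (I i).1) (z (I i).2) ^ 2 ≤ dist (I i).1 (I i).2 * (e (r i) - e (l i)) := by
    intro i hi
    have hrl : dist (I i).1 (I i).2 = r i - l i := by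
      rw [Real.dist_eq, max_sub_min_eq_abs']
    rw [hrl]
    have := hz (l i) (hl i hi) (r i) (hr i hi) (hlr i hi)
    refine le_trans (le_of_eq ?_) this
    rcases le_total (I i).1 (I i).2 with h | h
    · simp [l, r, h]
    · simp [l, r, h, dist_comm]
  have hcs : (∑ i ∈ Finset.range n, dist (z (I i).1) (z (I i).2)) ^ 2 ≤
      (∑ i ∈ Finset.range n, dist (I i).1 (I i).2) *
        ∑ i ∈ Finset.range n, (e (r i) - e (l i)) :=
    Finset.sum_sq_le_sum_mul_sum_of_sq_le_mul _ (fun i _ => dist_nonneg)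
      (fun i hi => sub_nonneg.2 (he (hl i hi) (hr i hi) (hlr i hi))) hdist
  have hE : 0 < e b - e a + 1 := by linarith
  rw [lt_div_iff₀ hE] at hlt
  refine lt_of_pow_lt_pow_left₀ 2 hε.le (hcs.trans_lt (lt_of_le_of_lt ?_ hlt))
  have h0 : 0 ≤ ∑ i ∈ Finset.range n, dist (I i).1 (I i).2 :=
    Finset.sum_nonneg fun _ _ => dist_nonneg
  exact mul_le_mul_of_nonneg_left (by linarith) h0

/-! ### Curves controlled by a monotone energy -/

section
variable {Z : Type*} [MetricSpace Z]

/-- Divide the squared bound by h² and let h tend to 0: the right side becomes the difference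
quotient of `e`. -/
theorem metricDeriv_sq_le_of_hasDerivAt {z : ℝ → Z} {e : ℝ → ℝ} {a b : ℝ}
    (hz : ∀ s ∈ Icc a b, ∀ t ∈ Icc a b, s ≤ t →
      dist (z s) (z t) ^ 2 ≤ (t - s) * (e t - e s)) {r : ℝ} (hr : r ∈ Ioo a b) {e' : ℝ}
    (he : HasDerivAt e e' r) : metricDeriv z r ^ 2 ≤ ENNReal.ofReal e' := by
  have hlim : Tendsto (fun h : ℝ => ENNReal.ofReal (√(h⁻¹ * (e (r + h) - e r)))) (𝓝[≠] 0)
      (𝓝 (ENNReal.ofReal (√e'))) := by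
    refine (ENNReal.continuous_ofReal.comp Real.continuous_sqrt).continuousAt.tendsto.comp ?_
    simpa using hasDerivAt_iff_tendsto_slope_zero.1 he
  have hle : metricDeriv z r ≤ ENNReal.ofReal (√e') := by
    rw [metricDeriv, ← hlim.limsup_eq]
    refine limsup_le_limsup ?_
    have hnear : ∀ᶠ h in 𝓝[≠] (0 : ℝ), r + h ∈ Ioo a b := by
      refine nhdsWithin_le_nhds ?_
      have : Tendsto (fun h : ℝ => r + h) (𝓝 0) (𝓝 r) := by
        have hc : Continuous fun h : ℝ => r + h := by fun_prop
        simpa using hc.tendsto 0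
      exact this.eventually (isOpen_Ioo.mem_nhds hr)
    filter_upwards [hnear, self_mem_nhdsWithin] with h hh h0
    have h0' : 0 < |h| := abs_pos.2 h0
    have key : dist (z (r + h)) (z r) ^ 2 ≤ h * (e (r + h) - e r) := by
      rcases le_total 0 h with hp | hp
      · have := hz r (Ioo_subset_Icc_self hr) (r + h) (Ioo_subset_Icc_self hh) (by linarith)
        rw [dist_comm]; simpa using this
      · have := hz (r + h) (Ioo_subset_Icc_self hh) r (Ioo_subset_Icc_self hr) (by linarith)
        nlinarith
    rw [edist_dist, ← ENNReal.ofReal_div_of_pos h0']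
    refine ENNReal.ofReal_le_ofReal (Real.le_sqrt_of_sq_le ?_)
    have h0' : h ≠ 0 := h0
    rw [div_pow, sq_abs, div_le_iff₀ (by positivity)]
    refine key.trans (le_of_eq ?_)
    field_simp
  calc metricDeriv z r ^ 2 ≤ ENNReal.ofReal (√e') ^ 2 := by gcongr
    _ = ENNReal.ofReal (√e' ^ 2) := (ENNReal.ofReal_pow (Real.sqrt_nonneg _) 2).symm
    _ ≤ _ := by
      rcases le_total 0 e' with h | h
      · rw [Real.sq_sqrt h]
      · rw [Real.sqrt_eq_zero_of_nonpos h]; simp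

theorem ae_metricDeriv_sq_le {z : ℝ → Z} {e : ℝ → ℝ} {a b : ℝ} (he : MonotoneOn e (Icc a b))
    (hz : ∀ s ∈ Icc a b, ∀ t ∈ Icc a b, s ≤ t →
      dist (z s) (z t) ^ 2 ≤ (t - s) * (e t - e s)) :
    ∀ᵐ r ∂volume.restrict (Icc a b), metricDeriv z r ^ 2 ≤ ENNReal.ofReal (deriv e r) := by
  rw [Measure.restrict_congr_set (Ioo_ae_eq_Icc (μ := volume) (a := a) (b := b)).symm,
    ae_restrict_iff' measurableSet_Ioo]
  filter_upwards [he.ae_differentiableWithinAt_of_mem] with r hr hr'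
  exact metricDeriv_sq_le_of_hasDerivAt hz hr' ((hr (Ioo_subset_Icc_self hr')).differentiableAt
    (Icc_mem_nhds hr'.1 hr'.2)).hasDerivAt

/-- The real function r ↦ d(z s, z r) is absolutely continuous, hence the integral of its
derivative, whose square is at most e'. -/
theorem IsACCurve.of_sq_dist_le {z : ℝ → Z} {e : ℝ → ℝ} {a b : ℝ} (hab : a ≤ b)
    (he : MonotoneOn e (Icc a b))
    (hz : ∀ s ∈ Icc a b, ∀ t ∈ Icc a b, s ≤ t →
      dist (z s) (z t) ^ 2 ≤ (t - s) * (e t - e s)) : IsACCurve z a b := by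
  have hint : IntegrableOn (deriv e) (Ioc a b) :=
    (intervalIntegrable_iff_integrableOn_Ioc_of_le hab).1
      (MonotoneOn.intervalIntegrable_deriv (by rwa [uIcc_of_le hab]))
  -- Since p ≤ 1 + p², this majorant avoids a square root, and it does not depend on the base point
  -- s.
  have hf : IntegrableOn (fun r => 1 + |deriv e r|) (Icc a b) := by
    rw [integrableOn_Icc_iff_integrableOn_Ioc]
    exact (integrableOn_const (by simp)).add hint.abs
  refine ⟨_, hf, fun s t has hst htb => ?_⟩
  have hsub : Icc s t ⊆ Icc a b := Icc_subset_Icc has htb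
  have hs : s ∈ Icc a b := ⟨has, hst.le.trans htb⟩
  have hz' : ∀ u ∈ Icc s t, ∀ v ∈ Icc s t, u ≤ v →
      dist (dist (z s) (z u)) (dist (z s) (z v)) ^ 2 ≤ (v - u) * (e v - e u) := by
    intro u hu v hv huv
    refine le_trans ?_ (hz u (hsub hu) v (hsub hv) huv)
    gcongr
    exact dist_dist_dist_le_right _ _ _
  have hac := absolutelyContinuousOnInterval_of_sq_dist_le hst.le (he.mono hsub) hz'
  have hftc := hac.integral_deriv_eq_sub
  have h1 := hac.intervalIntegrable_deriv
  simp only [dist_self, sub_zero] at hftc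
  rw [← hftc]
  refine intervalIntegral.integral_mono_ae_restrict hst.le h1 ?_ ?_
  · rw [intervalIntegrable_iff_integrableOn_Icc_of_le hst.le]
    exact hf.mono_set hsub
  rw [Measure.restrict_congr_set (Ioo_ae_eq_Icc (μ := volume) (a := s) (b := t)).symm,
    EventuallyLE, ae_restrict_iff' measurableSet_Ioo]
  filter_upwards [hac.ae_differentiableAt, he.ae_differentiableWithinAt_of_mem] with r hr1 hr2 hr
  have hd1 := (hr1 (by rw [uIcc_of_le hst.le]; exact Ioo_subset_Icc_self hr)).hasDerivAt
  have hd2 := ((hr2 (hsub (Ioo_subset_Icc_self hr))).differentiableAt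
    (Icc_mem_nhds (has.trans_lt hr.1) (hr.2.trans_le htb))).hasDerivAt
  have hsq : deriv (fun r => dist (z s) (z r)) r ^ 2 ≤ deriv e r := by
    have hr0 := hasDerivAt_iff_tendsto_slope_zero.1 hd1
    have hr3 := hasDerivAt_iff_tendsto_slope_zero.1 hd2
    refine le_of_tendsto_of_tendsto (hr0.pow 2) hr3 ?_
    have hnear : ∀ᶠ h in 𝓝[≠] (0 : ℝ), r + h ∈ Ioo s t := by
      refine nhdsWithin_le_nhds ?_
      have : Tendsto (fun h : ℝ => r + h) (𝓝 0) (𝓝 r) := by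
        have hc : Continuous fun h : ℝ => r + h := by fun_prop
        simpa using hc.tendsto 0
      exact this.eventually (isOpen_Ioo.mem_nhds hr)
    filter_upwards [hnear, self_mem_nhdsWithin] with h hh h0
    have h0' : h ≠ 0 := h0
    have key : (dist (z s) (z (r + h)) - dist (z s) (z r)) ^ 2 ≤ h * (e (r + h) - e r) := by
      rcases le_total 0 h with hp | hp
      · have := hz' r (Ioo_subset_Icc_self hr) (r + h) (Ioo_subset_Icc_self hh) (by linarith)
        rw [Real.dist_eq, sq_abs] at this
        nlinarith
      · have := hz' (r + h) (Ioo_subset_Icc_self hh) r (Ioo_subset_Icc_self hr) (by linarith)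
        rw [Real.dist_eq, sq_abs] at this
        nlinarith
    simp only [smul_eq_mul]
    have h2 : 0 < h ^ 2 := by positivity
    rw [mul_pow, inv_pow, inv_mul_le_iff₀ h2]
    refine key.trans (le_of_eq ?_)
    field_simp
  have := le_abs_self (deriv e r)
  nlinarith [sq_nonneg (deriv (fun r => dist (z s) (z r)) r - 1)]

/-! ### One minimizing step -/

theorem proxSet_le_self {F : Z → ℝ} {x u : Z} {τ : ℝ} (hu : u ∈ proxSet F x τ) :
    dist u x ^ 2 / (2 * τ) + F u ≤ F x := by
  simpa using hu x

/-- Minimality against v gives F u − F v ≤ d(u,v)·(d(v,x) + d(u,x))/(2τ) when the left side is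
positive, and the last factor tends to d(u,x)/τ as v → u. -/
theorem metricSlope_le_of_mem_proxSet {F : Z → ℝ} {x u : Z} {τ : ℝ} (hτ : 0 < τ)
    (hu : u ∈ proxSet F x τ) : metricSlope F u ≤ ENNReal.ofReal (dist u x / τ) := by
  have hlim : Tendsto (fun v : Z => ENNReal.ofReal ((dist v x + dist u x) / (2 * τ))) (𝓝[≠] u)
      (𝓝 (ENNReal.ofReal (dist u x / τ))) := by
    refine (ENNReal.continuous_ofReal.tendsto _).comp (tendsto_nhdsWithin_of_tendsto_nhds ?_)
    have : Continuous fun v : Z => (dist v x + dist u x) / (2 * τ) := by fun_prop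
    convert! this.tendsto u using 2
    field_simp; ring
  -- At an isolated point the punctured filter is `⊥` and the slope is 0; the limit of the majorant
  -- identifies its limsup only for a nontrivial filter.
  rcases eq_or_neBot (𝓝[≠] u) with h | h
  · rw [metricSlope, h]; simp [limsup_bot]
  rw [metricSlope, ← hlim.limsup_eq]
  refine limsup_le_limsup ?_
  filter_upwards [self_mem_nhdsWithin] with v hv
  have hd : 0 < dist u v := dist_pos.2 (Ne.symm hv)
  rw [edist_comm, edist_dist, dist_comm, ← ENNReal.ofReal_div_of_pos hd]
  refine ENNReal.ofReal_le_ofReal ?_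
  rw [div_le_div_iff₀ hd (by positivity)]
  have h1 := hu v
  have h2 : dist v x - dist u x ≤ dist u v := by
    linarith [dist_triangle v u x, dist_comm u v]
  have h3 : F u - F v ≤ (dist v x ^ 2 - dist u x ^ 2) / (2 * τ) := by
    rw [sub_div]; linarith
  rw [le_div_iff₀ (by positivity)] at h3
  have h4 : 0 ≤ dist v x + dist u x := by positivity
  nlinarith

/-- Exchanging the roles of the two minimizers bounds the increment of the minimal value between two
parameters from both sides. -/
theorem proxSet_value_sub {F : Z → ℝ} {x u v : Z} {s t : ℝ} (hs : 0 < s) (ht : 0 < t)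
    (hu : u ∈ proxSet F x s) :
    (dist u x ^ 2 / (2 * s) + F u) - (dist v x ^ 2 / (2 * t) + F v) ≤
      dist v x ^ 2 * (t - s) / (2 * s * t) := by
  have h := hu v
  have : dist v x ^ 2 * (t - s) / (2 * s * t) =
      dist v x ^ 2 / (2 * s) - dist v x ^ 2 / (2 * t) := by
    field_simp
  linarith

/-- Adding the two comparisons of minimizers eliminates `F`. -/
theorem proxSet_dist_mono {F : Z → ℝ} {x u v : Z} {s t : ℝ} (hs : 0 < s) (hst : s < t)
    (hu : u ∈ proxSet F x s) (hv : v ∈ proxSet F x t) : dist u x ≤ dist v x := by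
  have ht : 0 < t := hs.trans hst
  have h1 := proxSet_value_sub hs ht hu (v := v)
  have h2 := proxSet_value_sub ht hs hv (v := u)
  have h3 : dist u x ^ 2 * (s - t) / (2 * t * s) = - (dist u x ^ 2 * (t - s) / (2 * s * t)) := by
    field_simp; ring
  have h4 : dist u x ^ 2 * (t - s) / (2 * s * t) ≤ dist v x ^ 2 * (t - s) / (2 * s * t) := by
    linarith
  rw [div_le_div_iff_of_pos_right (by positivity)] at h4
  have := le_of_mul_le_mul_right h4 (sub_pos.2 hst)
  exact le_of_sq_le_sq this dist_nonneg

/-- De Giorgi's discrete energy inequality for a minimizing movement started at time `c`. -/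
theorem proxSet_deGiorgi {F : Z → ℝ} {x : Z} {c τ : ℝ} (hτ : 0 < τ) {u : ℝ → Z}
    (hu : ∀ r ∈ Ioc c (c + τ), u r ∈ proxSet F x (r - c)) :
    ∫⁻ r in Ioc c (c + τ), ENNReal.ofReal (dist (u r) x / (r - c)) ^ 2 ≤
      ENNReal.ofReal (2 * (F x - F (u (c + τ))) - dist (u (c + τ)) x ^ 2 / τ) := by
  -- Minus twice the minimal value, extended to r = c by −2F(x), which is what the competitor x
  -- gives. The factor 2 makes its derivative dominate the squared quotient.
  set ψ : ℝ → ℝ := fun r => if r ≤ c then -(2 * F x) else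
    -(2 * (dist (u r) x ^ 2 / (2 * (r - c)) + F (u r))) with hψ
  have hψ1 : ∀ r, c < r → ψ r = -(2 * (dist (u r) x ^ 2 / (2 * (r - c)) + F (u r))) :=
    fun r hr => by rw [hψ]; simp [not_le.2 hr]
  have hmono : MonotoneOn ψ (Icc c (c + τ)) := by
    intro s hs t ht hst
    rcases hst.eq_or_lt with rfl | hst
    · exact le_rfl
    have htc : c < t := hs.1.trans_lt hst
    rw [hψ1 t htc]
    rcases hs.1.eq_or_lt with rfl | hsc
    · have := proxSet_le_self (hu t ⟨htc, ht.2⟩)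
      rw [hψ]; simp only [le_refl, if_true]; linarith
    · rw [hψ1 s hsc]
      have h1 := proxSet_value_sub (sub_pos.2 htc) (sub_pos.2 hsc) (hu t ⟨htc, ht.2⟩) (v := u s)
      have h2 : dist (u s) x ^ 2 * (s - c - (t - c)) / (2 * (t - c) * (s - c)) ≤ 0 := by
        have h3 := sub_pos.2 htc
        have h4 := sub_pos.2 hsc
        refine div_nonpos_of_nonpos_of_nonneg ?_ (by positivity)
        exact mul_nonpos_of_nonneg_of_nonpos (sq_nonneg _) (by linarith)
      linarith
  have hmain := hmono.lintegral_le_of_hasDerivAt (by linarith)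
    (fun r => ENNReal.ofReal (dist (u r) x / (r - c)) ^ 2) ?_
  · rw [Measure.restrict_congr_set (Ioc_ae_eq_Icc (μ := volume))]
    refine hmain.trans (le_of_eq ?_)
    have : ψ c = -(2 * F x) := by rw [hψ]; simp
    rw [hψ1 _ (by linarith), this, add_sub_cancel_left]
    congr 1
    field_simp; ring
  · intro r hr e' he'
    have hrc : 0 < r - c := sub_pos.2 hr.1
    rw [← ENNReal.ofReal_pow (div_nonneg dist_nonneg hrc.le)]
    refine ENNReal.ofReal_le_ofReal ?_
    -- Right difference quotients suffice: testing the minimizer at r + h against u r bounds them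
    -- below by d(u r, x)²/((r−c)(r+h−c)).
    have hslope := (hasDerivAt_iff_tendsto_slope_zero.1 he').mono_left
      (nhdsWithin_mono 0 (fun h (hh : h ∈ Ioi (0 : ℝ)) => ne_of_gt hh))
    have hlim : Tendsto (fun h : ℝ => dist (u r) x ^ 2 / ((r - c) * (r + h - c))) (𝓝[>] 0)
        (𝓝 ((dist (u r) x / (r - c)) ^ 2)) := by
      refine tendsto_nhdsWithin_of_tendsto_nhds ?_
      have : ContinuousAt (fun h : ℝ => dist (u r) x ^ 2 / ((r - c) * (r + h - c))) 0 := by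
        refine ContinuousAt.div (by fun_prop) (by fun_prop) ?_
        have := hrc.ne'
        simpa using this
      convert! this.tendsto using 2
      simp only [add_zero]; rw [div_pow, sq (r - c)]
    refine le_of_tendsto_of_tendsto hlim hslope ?_
    have hnear : ∀ᶠ h in 𝓝[>] (0 : ℝ), h < c + τ - r :=
      nhdsWithin_le_nhds (gt_mem_nhds (by linarith [hr.2]))
    filter_upwards [hnear, self_mem_nhdsWithin] with h hh h0
    have h0' : 0 < h := h0
    rw [hψ1 _ hr.1, hψ1 _ (by linarith [hr.1])]
    have h1 := proxSet_value_sub hrc (show 0 < r + h - c by linarith)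
      (hu r ⟨hr.1, hr.2.le⟩) (v := u (r + h))
    have h2 := proxSet_value_sub (show 0 < r + h - c by linarith) hrc
      (hu (r + h) ⟨by linarith [hr.1], by linarith⟩) (v := u r)
    have h3 : dist (u r) x ^ 2 * (r - c - (r + h - c)) / (2 * (r + h - c) * (r - c)) =
        - (h * (dist (u r) x ^ 2 / ((r - c) * (r + h - c)))) / 2 := by
      field_simp
      ring
    rw [h3] at h2
    rw [smul_eq_mul, ← div_eq_inv_mul, le_div_iff₀ h0', mul_comm]
    linarith

/-- This is the source of measurability: the minimizers are selected arbitrarily, yet their distance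
to the starting point is monotone in time. -/
theorem monotoneOn_dist_of_mem_proxSet {F : Z → ℝ} {x : Z} {c τ : ℝ} {u : ℝ → Z}
    (hu : ∀ r ∈ Ioc c (c + τ), u r ∈ proxSet F x (r - c)) :
    MonotoneOn (fun r => dist (u r) x) (Ioc c (c + τ)) := by
  intro s hs t ht hst
  rcases hst.eq_or_lt with rfl | hst
  · exact le_rfl
  · exact proxSet_dist_mono (sub_pos.2 hs.1) (by linarith) (hu s hs) (hu t ht)

end

/-- The values of a curve at the multiples of `τ`. -/
def nodes {Z : Type*} (τ : ℝ) (u : ℝ → Z) (k : ℕ) : Z := u (k * τ)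

theorem nodes_succ {Z : Type*} (τ : ℝ) (u : ℝ → Z) (k : ℕ) :
    nodes τ u (k + 1) = u ((k + 1) * τ) := by
  simp [nodes]

/-! ### Chains of minimizing steps -/

section Chain
variable {Z : Type*} [MetricSpace Z]

/-- A chain of minimizing movements with functionals `F k`, interpolated à la de Giorgi. -/
def IsProxChain (F : ℕ → Z → ℝ) (τ : ℝ) (u : ℝ → Z) : Prop :=
  ∀ k : ℕ, ∀ t ∈ Ioc (k * τ) ((k + 1) * τ), u t ∈ proxSet (F k) (nodes τ u k) (t - k * τ)

/-- The index `k` with `r ∈ (kτ, (k+1)τ]`. -/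
noncomputable def cellIndex (τ r : ℝ) : ℕ := ⌈r / τ⌉₊ - 1

theorem cellIndex_eq {τ r : ℝ} (hτ : 0 < τ) {k : ℕ} (hr : r ∈ Ioc (k * τ) ((k + 1) * τ)) :
    cellIndex τ r = k := by
  have : ⌈r / τ⌉₊ = k + 1 := by
    rw [Nat.ceil_eq_iff (by omega)]
    constructor
    · rw [lt_div_iff₀ hτ]; simpa using hr.1
    · rw [div_le_iff₀ hτ]; simpa using hr.2
  rw [cellIndex, this]; rfl

theorem mem_cell {τ r : ℝ} (hτ : 0 < τ) (hr : 0 < r) :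
    r ∈ Ioc (cellIndex τ r * τ) ((cellIndex τ r + 1) * τ) := by
  have h1 : 0 < ⌈r / τ⌉₊ := Nat.ceil_pos.2 (div_pos hr hτ)
  obtain ⟨m, hm⟩ : ∃ m, ⌈r / τ⌉₊ = m + 1 := ⟨_, (Nat.succ_pred_eq_of_pos h1).symm⟩
  have h2 : cellIndex τ r = m := by rw [cellIndex, hm]; rfl
  rw [Nat.ceil_eq_iff (by omega), lt_div_iff₀ hτ, div_le_iff₀ hτ] at hm
  rw [h2]
  exact ⟨by simpa using hm.1, by simpa using hm.2⟩

/-- The difference quotient `d(u r, u(kτ)) / (r - kτ)` for `r ∈ (kτ, (k+1)τ]`. -/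
noncomputable def stepSpeed (τ : ℝ) (u : ℝ → Z) (r : ℝ) : ℝ≥0∞ :=
  ENNReal.ofReal (dist (u r) (nodes τ u (cellIndex τ r)) / (r - cellIndex τ r * τ))

variable {F : ℕ → Z → ℝ} {τ : ℝ} {u : ℝ → Z}

theorem IsProxChain.metricSlope_le (hu : IsProxChain F τ u) (hτ : 0 < τ) {r : ℝ} (hr : 0 < r) :
    metricSlope (F (cellIndex τ r)) (u r) ≤ stepSpeed τ u r :=
  metricSlope_le_of_mem_proxSet (sub_pos.2 (mem_cell hτ hr).1) (hu _ r (mem_cell hτ hr))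

theorem IsProxChain.aemeasurable_stepSpeed (hu : IsProxChain F τ u) (hτ : 0 < τ) (a : ℝ)
    (ha : 0 ≤ a) (b : ℝ) : AEMeasurable (stepSpeed τ u) (volume.restrict (Ioc a b)) := by
  have hsub : Ioc a b ⊆ ⋃ k : ℕ, Ioc (k * τ) ((k + 1) * τ) := fun r hr =>
    mem_iUnion.2 ⟨_, mem_cell hτ (ha.trans_lt hr.1)⟩
  refine AEMeasurable.mono_measure ?_ (Measure.restrict_mono hsub le_rfl)
  rw [aemeasurable_iUnion_iff]
  intro k
  have hm : AEMeasurable (fun r => dist (u r) (nodes τ u k))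
      (volume.restrict (Ioc (k * τ) ((k + 1) * τ))) := by
    refine aemeasurable_restrict_of_monotoneOn measurableSet_Ioc ?_
    have heq : ((k : ℝ) + 1) * τ = k * τ + τ := by ring
    rw [heq]
    refine monotoneOn_dist_of_mem_proxSet (F := F k) ?_
    rw [← heq]
    exact hu k
  have hd : AEMeasurable (fun r => ENNReal.ofReal (dist (u r) (nodes τ u k) / (r - k * τ)))
      (volume.restrict (Ioc (k * τ) ((k + 1) * τ))) :=
    (hm.div (by fun_prop)).ennreal_ofReal
  refine hd.congr ?_
  filter_upwards [ae_restrict_mem measurableSet_Ioc] with r hr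
  rw [stepSpeed, cellIndex_eq hτ hr]

theorem IsProxChain.node_le (hu : IsProxChain F τ u) (hτ : 0 < τ) (k : ℕ) :
    dist (nodes τ u k) (nodes τ u (k + 1)) ^ 2 / (2 * τ) + F k (nodes τ u (k + 1)) ≤
      F k (nodes τ u k) := by
  have h := proxSet_le_self (hu k ((k + 1) * τ) ⟨by nlinarith, le_rfl⟩)
  rw [dist_comm, nodes_succ]
  convert! h using 4
  ring

theorem IsProxChain.lintegral_stepSpeed_le (hu : IsProxChain F τ u) (hτ : 0 < τ) {K M : ℕ}
    (hKM : K ≤ M) :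
    ∫⁻ r in Ioc (K * τ) (M * τ), stepSpeed τ u r ^ 2 ≤ ENNReal.ofReal
      (∑ k ∈ Finset.Ico K M, (2 * (F k (nodes τ u k) - F k (nodes τ u (k + 1))) -
        dist (nodes τ u k) (nodes τ u (k + 1)) ^ 2 / τ)) := by
  have hnn : ∀ k, 0 ≤ 2 * (F k (nodes τ u k) - F k (nodes τ u (k + 1))) -
        dist (nodes τ u k) (nodes τ u (k + 1)) ^ 2 / τ := by
    intro k
    have := hu.node_le hτ k
    have h2 : dist (nodes τ u k) (nodes τ u (k + 1)) ^ 2 / (2 * τ) =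
      dist (nodes τ u k) (nodes τ u (k + 1)) ^ 2 / τ / 2 := by field_simp
    linarith
  induction M, hKM using Nat.le_induction with
  | base => simp
  | succ M hKM ih =>
    rw [Finset.sum_Ico_succ_top hKM,
      ENNReal.ofReal_add (Finset.sum_nonneg fun k _ => hnn k) (hnn M)]
    have hun : Ioc (K * τ) ((M + 1 : ℕ) * τ) ⊆
        Ioc (K * τ) (M * τ) ∪ Ioc (M * τ) ((M + 1) * τ) := by
      intro r hr
      rcases le_or_gt r (M * τ) with h | h
      · exact Or.inl ⟨hr.1, h⟩
      · exact Or.inr ⟨h, by simpa using hr.2⟩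
    refine (lintegral_mono_set hun).trans ((lintegral_union_le _ _ _).trans (add_le_add ih ?_))
    have heq : ((M : ℝ) + 1) * τ = M * τ + τ := by ring
    have h := proxSet_deGiorgi hτ (F := F M) (x := nodes τ u M) (c := M * τ) (u := u)
      (by rw [← heq]; exact hu M)
    rw [← heq, ← nodes_succ τ u M, dist_comm] at h
    refine le_trans (le_of_eq ?_) h
    refine setLIntegral_congr_fun measurableSet_Ioc fun r hr => ?_
    simp only [stepSpeed]
    rw [cellIndex_eq hτ hr]

theorem sq_dist_le_mul_sum_Ico (p : ℕ → Z) {K M : ℕ} (h : K ≤ M) :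
    dist (p K) (p M) ^ 2 ≤ (M - K) * ∑ k ∈ Finset.Ico K M, dist (p k) (p (k + 1)) ^ 2 := by
  calc dist (p K) (p M) ^ 2 ≤ (∑ k ∈ Finset.Ico K M, dist (p k) (p (k + 1))) ^ 2 := by
        gcongr; exact dist_le_Ico_sum_dist p h
    _ ≤ (Finset.Ico K M).card * ∑ k ∈ Finset.Ico K M, dist (p k) (p (k + 1)) ^ 2 :=
        sq_sum_le_card_mul_sum_sq
    _ = _ := by rw [Nat.card_Ico, Nat.cast_sub h]

/-- Bounds of order `τ` on the steps of a discrete curve on `[0, T]`. -/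
structure StepBound (T τ A : ℝ) (u : ℝ → Z) : Prop where
  cell : ∀ k : ℕ, k * τ ≤ T → ∀ t ∈ Ioc (k * τ) ((k + 1) * τ),
    dist (u t) (nodes τ u k) ^ 2 ≤ A * τ
  sum : ∀ N : ℕ, N * τ ≤ T →
    ∑ k ∈ Finset.range N, dist (nodes τ u k) (nodes τ u (k + 1)) ^ 2 ≤ A * τ

theorem StepBound.sum_Ico {T A : ℝ} (h : StepBound T τ A u) (K : ℕ) {M : ℕ} (hM : M * τ ≤ T) :
    ∑ k ∈ Finset.Ico K M, dist (nodes τ u k) (nodes τ u (k + 1)) ^ 2 ≤ A * τ := by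
  refine le_trans (Finset.sum_le_sum_of_subset_of_nonneg ?_ fun _ _ _ => sq_nonneg _) (h.sum M hM)
  rw [Finset.range_eq_Ico]
  exact Finset.Ico_subset_Ico_left (Nat.zero_le _)

theorem StepBound.exists_node {T A : ℝ} (h : StepBound T τ A u) (hτ : 0 < τ) {r : ℝ}
    (hr : r ∈ Icc 0 T) : cellIndex τ r * τ ≤ r ∧ r ≤ (cellIndex τ r + 1) * τ ∧
      dist (u r) (nodes τ u (cellIndex τ r)) ≤ √(A * τ) := by
  -- At r = 0 the truncated subtraction gives cell index 0, so the node is u 0 itself, although 0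
  -- lies in no cell.
  rcases hr.1.eq_or_lt with rfl | h0
  · simp [cellIndex, nodes, hτ.le, mul_nonneg, Real.sqrt_nonneg]
  · have hc := mem_cell hτ h0
    exact ⟨hc.1.le, hc.2, Real.le_sqrt_of_sq_le (h.cell _ (hc.1.le.trans hr.2) r hc)⟩

theorem StepBound.dist_nodes_le {T A : ℝ} (h : StepBound T τ A u) {K M : ℕ}
    (hKM : K ≤ M) (hM : M * τ ≤ T) :
    dist (nodes τ u K) (nodes τ u M) ≤ √(A * ((M - K) * τ)) := by
  refine Real.le_sqrt_of_sq_le ((sq_dist_le_mul_sum_Ico _ hKM).trans ?_)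
  have : (0 : ℝ) ≤ M - K := by rw [sub_nonneg]; exact_mod_cast hKM
  calc ((M : ℝ) - K) * _ ≤ (M - K) * (A * τ) := by gcongr; exact h.sum_Ico K hM
    _ = _ := by ring

/-- Replacing each of the two points by a node costs √(Aτ), and Cauchy–Schwarz makes the nodes
Hölder-½; three such terms explain the factor 3. -/
theorem StepBound.dist_le {T A : ℝ} (h : StepBound T τ A u) (hτ : 0 < τ) (hA : 0 ≤ A) {r s : ℝ}
    (hr : r ∈ Icc 0 T) (hs : s ∈ Icc 0 T) : dist (u r) (u s) ≤ 3 * √(A * (|r - s| + τ)) := by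
  wlog hrs : r ≤ s generalizing r s
  · rw [dist_comm, abs_sub_comm]; exact this hs hr (le_of_not_ge hrs)
  obtain ⟨h1, h2, h3⟩ := h.exists_node hτ hr
  obtain ⟨h4, h5, h6⟩ := h.exists_node hτ hs
  have hKM : cellIndex τ r ≤ cellIndex τ s := by
    unfold cellIndex
    have : ⌈r / τ⌉₊ ≤ ⌈s / τ⌉₊ := Nat.ceil_mono (by gcongr)
    omega
  have h7 := h.dist_nodes_le hKM (h4.trans hs.2)
  have habs : |r - s| = s - r := by rw [abs_sub_comm]; exact abs_of_nonneg (sub_nonneg.2 hrs)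
  have h8 : √(A * τ) ≤ √(A * (|r - s| + τ)) := by
    gcongr; linarith [abs_nonneg (r - s)]
  have h9 : √(A * (((cellIndex τ s : ℝ) - cellIndex τ r) * τ)) ≤ √(A * (|r - s| + τ)) := by
    gcongr
    rw [habs]; nlinarith
  have := dist_triangle4 (u r) (nodes τ u (cellIndex τ r)) (nodes τ u (cellIndex τ s)) (u s)
  rw [dist_comm (nodes τ u (cellIndex τ s)) (u s)] at this
  linarith

end Chain

/-! ### A priori bounds for the alternating scheme -/

section Scheme
variable {X Y : Type*} [MetricSpace X] [MetricSpace Y] {Cx Cy : X → Y → ℝ} {x₀ : X} {y₀ : Y}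
  {τ : ℝ} {z : ℝ → X × Y}

theorem IsDeGiorgiCurve.chain_fst (hz : IsDeGiorgiCurve Cx Cy x₀ y₀ τ z) :
    IsProxChain (fun k u => Cx u (nodes τ (fun t => (z t).2) k)) τ fun t => (z t).1 :=
  hz.step_x

theorem IsDeGiorgiCurve.chain_snd (hz : IsDeGiorgiCurve Cx Cy x₀ y₀ τ z) :
    IsProxChain (fun k v => Cy (nodes τ (fun t => (z t).1) (k + 1)) v) τ fun t => (z t).2 := by
  intro k
  simp only [nodes_succ]
  exact hz.step_y k

/-- Minimality spends d²/(2τ) in each half of a step. The cost of the player who does not move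
changes by at most L·d ≤ L²τ + d²/(4τ), so half of the dissipation survives and each full step adds
at most 2L²τ. -/
theorem IsDeGiorgiCurve.energy_le {L : ℝ}
    (hLx : ∀ x y y', Cx x y ≤ Cx x y' + L * dist y' y)
    (hLy : ∀ x x' y, Cy x y ≤ Cy x' y + L * dist x' x)
    (hτ : 0 < τ) (hz : IsDeGiorgiCurve Cx Cy x₀ y₀ τ z) (N : ℕ) :
    let p := nodes τ fun t => (z t).1
    let q := nodes τ fun t => (z t).2
    Cx (p N) (q N) + Cy (p N) (q N) +
      (∑ k ∈ Finset.range N, (dist (p k) (p (k + 1)) ^ 2 + dist (q k) (q (k + 1)) ^ 2)) / (4 * τ) ≤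
      Cx x₀ y₀ + Cy x₀ y₀ + 2 * L ^ 2 * (N * τ) := by
  intro p q
  induction N with
  | zero => simp [p, q, nodes, hz.start]
  | succ N ih =>
    have h1 : _ ≤ Cx (p N) (q N) := hz.chain_fst.node_le hτ N
    have h2 : _ ≤ Cy (p (N + 1)) (q N) := hz.chain_snd.node_le hτ N
    have h3 := hLx (p (N + 1)) (q (N + 1)) (q N)
    have h4 := hLy (p (N + 1)) (p N) (q N)
    change dist (p N) (p (N + 1)) ^ 2 / (2 * τ) + Cx (p (N + 1)) (q N) ≤ _ at h1
    change dist (q N) (q (N + 1)) ^ 2 / (2 * τ) + Cy (p (N + 1)) (q (N + 1)) ≤ _ at h2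
    have young : ∀ d : ℝ, L * d ≤ L ^ 2 * τ + d ^ 2 / (4 * τ) := by
      intro d
      have : L ^ 2 * τ + d ^ 2 / (4 * τ) - L * d = (2 * τ * L - d) ^ 2 / (4 * τ) := by
        field_simp; ring
      have : 0 ≤ (2 * τ * L - d) ^ 2 / (4 * τ) := by positivity
      linarith
    have h5 := young (dist (p N) (p (N + 1)))
    have h6 := young (dist (q N) (q (N + 1)))
    have h7 : ∀ d : ℝ, d ^ 2 / (2 * τ) = 2 * (d ^ 2 / (4 * τ)) := by intro d; field_simp; ring
    rw [Finset.sum_range_succ, add_div, add_div]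
    rw [h7] at h1 h2
    push_cast
    linarith

theorem IsDeGiorgiCurve.exists_bound {C₁ L : ℝ}
    (hbelow : ∀ x y, -C₁ ≤ Cx x y ∧ -C₁ ≤ Cy x y)
    (hLx : ∀ x y y', Cx x y ≤ Cx x y' + L * dist y' y)
    (hLy : ∀ x x' y, Cy x y ≤ Cy x' y + L * dist x' x) (x₀ : X) (y₀ : Y) (T τbar : ℝ) :
    ∃ A : ℝ, 0 < A ∧ ∀ τ, 0 < τ → τ ≤ τbar → ∀ z, IsDeGiorgiCurve Cx Cy x₀ y₀ τ z →
      StepBound T τ A (fun t => (z t).1) ∧ StepBound T τ A (fun t => (z t).2) ∧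
      ∀ k : ℕ, k * τ ≤ T → ∀ t ∈ Ioc (k * τ) ((k + 1) * τ),
        Cx (z t).1 (z (k * τ)).2 ≤ A ∧ Cy (z ((k + 1) * τ)).1 (z t).2 ≤ A := by
  -- The energy budget up to time T + τbar, because a cell that starts before T may end after it. In
  -- `A`, 4|b| bounds the node sums and the doubled bracket bounds the positions inside a cell.
  set b := Cx x₀ y₀ + Cy x₀ y₀ + 2 * C₁ + 2 * L ^ 2 * (T + τbar) with hb
  set A := 4 * |b| + 2 * (2 * |b| + L ^ 2 * |τbar| + 2 * |C₁|) + 1 with hA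
  have hA0 : 0 < A := by positivity
  refine ⟨A, hA0, fun τ hτ hτb z hz => ?_⟩
  set p := nodes τ fun t => (z t).1 with hp
  set q := nodes τ fun t => (z t).2 with hq
  have hen := hz.energy_le hLx hLy hτ
  simp only [← hp, ← hq] at hen
  have hnode : ∀ N : ℕ, N * τ ≤ T + τbar → 2 * L ^ 2 * (N * τ) ≤ 2 * L ^ 2 * (T + τbar) :=
    fun N hN => by gcongr
  have hsum : ∀ N : ℕ, N * τ ≤ T + τbar → ∑ k ∈ Finset.range N,
      (dist (p k) (p (k + 1)) ^ 2 + dist (q k) (q (k + 1)) ^ 2) ≤ 4 * |b| * τ := by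
    intro N hN
    have h1 := hen N
    have h2 := hbelow (p N) (q N)
    have h3 := hnode N hN
    have h4 : (∑ k ∈ Finset.range N, (dist (p k) (p (k + 1)) ^ 2 + dist (q k) (q (k + 1)) ^ 2)) /
      (4 * τ) ≤ |b| := le_trans (by linarith [h2.1, h2.2]) (le_abs_self b)
    rw [div_le_iff₀ (by positivity)] at h4
    linarith
  have hval : ∀ N : ℕ, N * τ ≤ T + τbar → Cx (p N) (q N) ≤ |b| + |C₁| ∧
      Cy (p N) (q N) ≤ |b| + |C₁| := by
    intro N hN
    have h1 := hen N
    have h2 := hbelow (p N) (q N)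
    have h3 := hnode N hN
    have h4 : 0 ≤ (∑ k ∈ Finset.range N,
        (dist (p k) (p (k + 1)) ^ 2 + dist (q k) (q (k + 1)) ^ 2)) / (4 * τ) := by positivity
    have h5 := le_abs_self b
    have h6 := neg_abs_le C₁
    constructor <;> linarith [h2.1, h2.2]
  -- The y-step starts from Cy at the updated x, a value not controlled by `hval`; the Lipschitz
  -- bound and the size of the x-step recover it.
  have hval' : ∀ k : ℕ, k * τ ≤ T → Cy (p (k + 1)) (q k) ≤ 2 * |b| + L ^ 2 * |τbar| + |C₁| := by
    intro k hk
    have hk' : ((k + 1 : ℕ) : ℝ) * τ ≤ T + τbar := by push_cast; linarith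
    have h1 := hval k (by linarith)
    have h2 := hLy (p (k + 1)) (p k) (q k)
    have h3 := hsum (k + 1) hk'
    rw [Finset.sum_range_succ] at h3
    have h4 : 0 ≤ ∑ k ∈ Finset.range k,
        (dist (p k) (p (k + 1)) ^ 2 + dist (q k) (q (k + 1)) ^ 2) := by positivity
    have h5 : dist (p k) (p (k + 1)) ^ 2 ≤ 4 * |b| * τ := by
      nlinarith [sq_nonneg (dist (q k) (q (k + 1)))]
    have h6 : L * dist (p k) (p (k + 1)) ≤ L ^ 2 * τ + dist (p k) (p (k + 1)) ^ 2 / (4 * τ) := by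
      have e1 : L ^ 2 * τ + dist (p k) (p (k + 1)) ^ 2 / (4 * τ) - L * dist (p k) (p (k + 1)) =
        (2 * τ * L - dist (p k) (p (k + 1))) ^ 2 / (4 * τ) := by
        field_simp; ring
      have : 0 ≤ (2 * τ * L - dist (p k) (p (k + 1))) ^ 2 / (4 * τ) := by positivity
      linarith
    have h7 : dist (p k) (p (k + 1)) ^ 2 / (4 * τ) ≤ |b| := by
      rw [div_le_iff₀ (by positivity)]; linarith
    have h8 : L ^ 2 * τ ≤ L ^ 2 * |τbar| := by gcongr; exact hτb.trans (le_abs_self _)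
    linarith [h1.2]
  have hL2 : 0 ≤ L ^ 2 * |τbar| := by positivity
  have hb0 := abs_nonneg b
  have hC0 := abs_nonneg C₁
  have hcell : ∀ k : ℕ, k * τ ≤ T → ∀ t ∈ Ioc (k * τ) ((k + 1) * τ),
      (dist (z t).1 (p k) ^ 2 ≤ A * τ ∧ Cx (z t).1 (q k) ≤ A) ∧
      (dist (z t).2 (q k) ^ 2 ≤ A * τ ∧ Cy (p (k + 1)) (z t).2 ≤ A) := by
    intro k hk t ht
    have htk : 0 < t - k * τ := sub_pos.2 ht.1
    have hgen : ∀ d f g : ℝ, d ^ 2 / (2 * (t - k * τ)) + f ≤ g → -C₁ ≤ f →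
        g ≤ 2 * |b| + L ^ 2 * |τbar| + |C₁| → d ^ 2 ≤ A * τ ∧ f ≤ A := by
      intro d f g h1 h2 h3
      have h4 : 0 ≤ d ^ 2 / (2 * (t - k * τ)) := by positivity
      refine ⟨?_, by linarith⟩
      have h5 : d ^ 2 / (2 * (t - k * τ)) ≤ 2 * |b| + L ^ 2 * |τbar| + 2 * |C₁| := by
        linarith [le_abs_self C₁]
      rw [div_le_iff₀ (by positivity)] at h5
      have h6 : t - k * τ ≤ τ := by linarith [ht.2]
      have h7 : (2 * |b| + L ^ 2 * |τbar| + 2 * |C₁|) * (2 * (t - k * τ)) ≤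
        (2 * |b| + L ^ 2 * |τbar| + 2 * |C₁|) * (2 * τ) := by gcongr
      nlinarith
    refine ⟨hgen _ _ _ (proxSet_le_self (hz.chain_fst k t ht)) (hbelow _ _).1 ?_,
      hgen _ _ _ (proxSet_le_self (hz.chain_snd k t ht)) (hbelow _ _).2 (hval' k hk)⟩
    have := (hval k (by linarith)).1
    change Cx (p k) (q k) ≤ _
    linarith
  refine ⟨⟨fun k hk t ht => (hcell k hk t ht).1.1, fun N hN => ?_⟩,
    ⟨fun k hk t ht => (hcell k hk t ht).2.1, fun N hN => ?_⟩, fun k hk t ht => ?_⟩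
  · have := hsum N (by linarith)
    rw [Finset.sum_add_distrib] at this
    have h2 : 0 ≤ ∑ k ∈ Finset.range N, dist (q k) (q (k + 1)) ^ 2 := by positivity
    change ∑ k ∈ Finset.range N, dist (p k) (p (k + 1)) ^ 2 ≤ _
    nlinarith
  · have := hsum N (by linarith)
    rw [Finset.sum_add_distrib] at this
    have h2 : 0 ≤ ∑ k ∈ Finset.range N, dist (p k) (p (k + 1)) ^ 2 := by positivity
    change ∑ k ∈ Finset.range N, dist (q k) (q (k + 1)) ^ 2 ≤ _
    nlinarith
  · refine ⟨(hcell k hk t ht).1.2, ?_⟩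
    have := (hcell k hk t ht).2.2
    rwa [hp, nodes_succ] at this

end Scheme

/-- A discontinuous version of the Arzelà–Ascoli theorem: asymptotically equicontinuous sequences
of curves with values in a compact set have uniformly convergent subsequences. -/
theorem exists_subseq_tendstoUniformlyOn {Z : Type*} [MetricSpace Z] {K : Set Z}
    (hK : IsCompact K) {T : ℝ} (hT : 0 < T) (f : ℕ → ℝ → Z) (hf : ∀ n, ∀ t ∈ Icc 0 T, f n t ∈ K)
    (hmod : ∀ ε > 0, ∃ δ > 0, ∀ᶠ n in atTop, ∀ r ∈ Icc 0 T, ∀ s ∈ Icc 0 T, |r - s| < δ →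
      dist (f n r) (f n s) < ε) :
    ∃ (φ : ℕ → ℕ) (g : ℝ → Z), StrictMono φ ∧
      TendstoUniformlyOn (fun n => f (φ n)) g atTop (Icc 0 T) := by
  classical
  have h0T : (0 : ℝ) ∈ Icc 0 T := left_mem_Icc.2 hT.le
  -- Restricting to rational times and filling in f n 0 outside [0, T] puts all curves in the
  -- compact metrizable space K^ℚ, which replaces a diagonal extraction.
  set G : ℕ → ℚ → Z := fun n q => if (q : ℝ) ∈ Icc 0 T then f n q else f n 0 with hG
  have hGK : ∀ n, G n ∈ Set.pi univ fun _ : ℚ => K := by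
    intro n q _
    by_cases hq : (q : ℝ) ∈ Icc 0 T
    · simp only [hG, if_pos hq]; exact hf n _ hq
    · simp only [hG, if_neg hq]; exact hf n 0 h0T
  obtain ⟨g, -, φ, hφ, hlim⟩ := (isCompact_univ_pi fun _ : ℚ => hK).tendsto_subseq hGK
  rw [tendsto_pi_nhds] at hlim
  have hrat : ∀ q : ℚ, (q : ℝ) ∈ Icc 0 T → CauchySeq fun n => f (φ n) q := by
    intro q hq
    have := (hlim q).cauchySeq
    simpa only [hG, Function.comp_apply, if_pos hq] using this
  have hunif : UniformCauchySeqOn (fun n => f (φ n)) atTop (Icc 0 T) := by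
    rw [Metric.uniformCauchySeqOn_iff]
    intro ε hε
    obtain ⟨δ, hδ, hev⟩ := hmod (ε / 3) (by positivity)
    obtain ⟨N₁, hN₁⟩ := eventually_atTop.1 (hφ.tendsto_atTop.eventually hev)
    obtain ⟨S, hS⟩ := (isCompact_Icc (a := (0 : ℝ)) (b := T)).elim_finite_subcover
      (fun q : {q : ℚ // (q : ℝ) ∈ Icc 0 T} => Metric.ball ((q : ℚ) : ℝ) δ)
      (fun _ => Metric.isOpen_ball) (by
        intro r hr
        obtain ⟨q, hq1, hq2⟩ := exists_rat_btwn (show max 0 (r - δ) < min T (r + δ) by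
          rw [max_lt_iff, lt_min_iff, lt_min_iff]
          exact ⟨⟨hT, by linarith [hr.1]⟩, by linarith [hr.2], by linarith⟩)
        rw [max_lt_iff] at hq1
        rw [lt_min_iff] at hq2
        refine mem_iUnion.2 ⟨⟨q, hq1.1.le, hq2.1.le⟩, ?_⟩
        rw [Metric.mem_ball, Real.dist_eq, abs_lt]
        constructor <;> linarith [hq1.2, hq2.2])
    have hfin : ∀ᶠ N in atTop, ∀ q ∈ S, ∀ m ≥ N, ∀ n ≥ N,
        dist (f (φ m) (q : ℚ)) (f (φ n) (q : ℚ)) < ε / 3 := by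
      rw [Finset.eventually_all]
      intro q _
      obtain ⟨N, hN⟩ := Metric.cauchySeq_iff.1 (hrat q q.2) (ε / 3) (by positivity)
      filter_upwards [eventually_ge_atTop N] with M hM m hm n hn
      exact hN m (hM.trans hm) n (hM.trans hn)
    obtain ⟨N, hN2, hN3⟩ := (hfin.and (eventually_ge_atTop N₁)).exists
    refine ⟨N, fun m hm n hn r hr => ?_⟩
    obtain ⟨q, hqS, hq⟩ := mem_iUnion₂.1 (hS hr)
    rw [Metric.mem_ball, Real.dist_eq] at hq
    have h1 := hN₁ m (hN3.trans hm) r hr _ q.2 hq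
    have h2 := hN₁ n (hN3.trans hn) _ q.2 r hr (by rwa [abs_sub_comm])
    have h3 := hN2 q hqS m hm n hn
    linarith [dist_triangle4 (f (φ m) r) (f (φ m) (q : ℚ)) (f (φ n) (q : ℚ)) (f (φ n) r)]
  have hpt : ∀ r : ℝ, ∃ w : Z, r ∈ Icc 0 T → Tendsto (fun n => f (φ n) r) atTop (𝓝 w) := by
    intro r
    by_cases hr : r ∈ Icc 0 T
    · obtain ⟨w, -, hw⟩ := cauchySeq_tendsto_of_isComplete hK.isComplete (fun n => hf (φ n) r hr)
        (hunif.cauchySeq hr)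
      exact ⟨w, fun _ => hw⟩
    · exact ⟨f 0 0, fun h => absurd h hr⟩
  choose w hw using hpt
  exact ⟨φ, w, hφ, hunif.tendstoUniformlyOn_of_tendsto hw⟩

/-! ### Compactness of the discrete curves -/

section Scheme
variable {X Y : Type*} [MetricSpace X] [MetricSpace Y] {Cx Cy : X → Y → ℝ} {x₀ : X} {y₀ : Y}

theorem StepBound.prod_dist_le {T τ A : ℝ} {z : ℝ → X × Y}
    (hx : StepBound T τ A fun t => (z t).1) (hy : StepBound T τ A fun t => (z t).2)
    (hτ : 0 < τ) (hA : 0 ≤ A) {r s : ℝ} (hr : r ∈ Icc 0 T) (hs : s ∈ Icc 0 T) :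
    dist (z r) (z s) ≤ 3 * √(A * (|r - s| + τ)) :=
  max_le (hx.dist_le hτ hA hr hs) (hy.dist_le hτ hA hr hs)

/-- The frozen argument varies from cell to cell, but moving it to y₀ or x₀ costs at most L·R, so a
single sublevel set in a single ball contains each coordinate. -/
theorem IsDeGiorgiCurve.exists_compact {C₁ L : ℝ} (hL : 0 ≤ L)
    (hbelow : ∀ x y, -C₁ ≤ Cx x y ∧ -C₁ ≤ Cy x y)
    (hcompact : ∀ (c r : ℝ), 0 < r → ∀ (x : X) (y : Y),
      IsCompact {u : X | Cx u y ≤ c ∧ dist u x ≤ r} ∧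
      IsCompact {v : Y | Cy x v ≤ c ∧ dist v y ≤ r})
    (hLx : ∀ x y y', Cx x y ≤ Cx x y' + L * dist y' y)
    (hLy : ∀ x x' y, Cy x y ≤ Cy x' y + L * dist x' x) (x₀ : X) (y₀ : Y) {T τbar : ℝ} :
    ∃ K : Set (X × Y), IsCompact K ∧ ∀ τ, 0 < τ → τ ≤ τbar → ∀ z : ℝ → X × Y,
      IsDeGiorgiCurve Cx Cy x₀ y₀ τ z → ∀ t ∈ Icc 0 T, z t ∈ K := by
  -- The horizon is T + τbar since the y-coordinate at time t refers to x at the right end of its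
  -- cell.
  obtain ⟨A, hA, hAb⟩ := IsDeGiorgiCurve.exists_bound hbelow hLx hLy x₀ y₀ (T + τbar) τbar
  set R := 3 * √(A * (T + 2 * τbar)) + 1 with hR
  have hR0 : 0 < R := by positivity
  set c := |Cx x₀ y₀| + |Cy x₀ y₀| + A + L * R with hc
  have hLR : 0 ≤ L * R := by positivity
  refine ⟨_, (hcompact c R hR0 x₀ y₀).1.prod (hcompact c R hR0 x₀ y₀).2,
    fun τ hτ hτb z hz t ht => ?_⟩
  obtain ⟨hx, hy, hval⟩ := hAb τ hτ hτb z hz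
  have hball : ∀ r ∈ Icc 0 (T + τbar), dist (z r).1 x₀ ≤ R ∧ dist (z r).2 y₀ ≤ R := by
    intro r hr
    have h1 := hx.prod_dist_le hy hτ hA.le hr (left_mem_Icc.2 (hr.1.trans hr.2))
    rw [hz.start] at h1
    have h2 : 3 * √(A * (|r - 0| + τ)) ≤ R := by
      have : √(A * (|r - 0| + τ)) ≤ √(A * (T + 2 * τbar)) := by
        refine Real.sqrt_le_sqrt (mul_le_mul_of_nonneg_left ?_ hA.le)
        rw [sub_zero, abs_of_nonneg hr.1]; linarith [hr.2]
      linarith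
    exact max_le_iff.1 (h1.trans h2)
  have h1 := hball t ⟨ht.1, by linarith [ht.2]⟩
  have ha1 := le_abs_self (Cx x₀ y₀)
  have ha2 := le_abs_self (Cy x₀ y₀)
  have ha3 := abs_nonneg (Cx x₀ y₀)
  have ha4 := abs_nonneg (Cy x₀ y₀)
  refine ⟨⟨?_, h1.1⟩, ?_, h1.2⟩
  all_goals rcases ht.1.eq_or_lt with rfl | ht0
  · rw [hz.start]; linarith
  · have hc := mem_cell hτ ht0
    have h2 := hval _ (by linarith [hc.1, ht.2]) t hc
    have h3 := hLx (z t).1 y₀ (z (cellIndex τ t * τ)).2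
    have h4 := (hball (cellIndex τ t * τ) ⟨by positivity, by linarith [hc.1, ht.2]⟩).2
    have h5 := mul_le_mul_of_nonneg_left h4 hL
    linarith [h2.1]
  · rw [hz.start]; linarith
  · have hc := mem_cell hτ ht0
    have h2 := hval _ (by linarith [hc.1, ht.2]) t hc
    have h3 := hLy x₀ (z ((cellIndex τ t + 1) * τ)).1 (z t).2
    have h4 := (hball ((cellIndex τ t + 1) * τ) ⟨by positivity, by linarith [hc.1, ht.2]⟩).1
    have h5 := mul_le_mul_of_nonneg_left h4 hL
    linarith [h2.2]

theorem exists_forall_sqrt_lt {A : ℝ} (hA : 0 < A) {ε : ℝ} (hε : 0 < ε) :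
    ∃ δ > 0, ∀ h < δ, 3 * √(A * h) < ε := by
  refine ⟨(ε / 3) ^ 2 / A, by positivity, fun h hh => ?_⟩
  rw [lt_div_iff₀ hA] at hh
  have : √(A * h) < ε / 3 := (Real.sqrt_lt' (by positivity)).2 (by linarith)
  linarith

theorem IsDeGiorgiCurve.exists_subseq {C₁ L : ℝ} (hL : 0 ≤ L)
    (hbelow : ∀ x y, -C₁ ≤ Cx x y ∧ -C₁ ≤ Cy x y)
    (hcompact : ∀ (c r : ℝ), 0 < r → ∀ (x : X) (y : Y),
      IsCompact {u : X | Cx u y ≤ c ∧ dist u x ≤ r} ∧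
      IsCompact {v : Y | Cy x v ≤ c ∧ dist v y ≤ r})
    (hLx : ∀ x y y', Cx x y ≤ Cx x y' + L * dist y' y)
    (hLy : ∀ x x' y, Cy x y ≤ Cy x' y + L * dist x' x) {T τbar : ℝ}
    (hT : 0 < T) (τ : ℕ → ℝ) (zs : ℕ → ℝ → X × Y) (hτ : ∀ n, 0 < τ n ∧ τ n ≤ τbar)
    (hτ0 : Tendsto τ atTop (𝓝 0)) (hz : ∀ n, IsDeGiorgiCurve Cx Cy x₀ y₀ (τ n) (zs n)) :
    ∃ (φ : ℕ → ℕ) (z : ℝ → X × Y), StrictMono φ ∧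
      TendstoUniformlyOn (fun n => zs (φ n)) z atTop (Icc 0 T) := by
  obtain ⟨K, hK, hKz⟩ := IsDeGiorgiCurve.exists_compact hL hbelow hcompact hLx hLy x₀ y₀
    (T := T) (τbar := τbar)
  obtain ⟨A, hA, hAb⟩ := IsDeGiorgiCurve.exists_bound hbelow hLx hLy x₀ y₀ T τbar
  refine exists_subseq_tendstoUniformlyOn hK hT zs
    (fun n => hKz (τ n) (hτ n).1 (hτ n).2 (zs n) (hz n)) fun ε hε => ?_
  obtain ⟨δ, hδ, hδε⟩ := exists_forall_sqrt_lt hA hε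
  -- One half of δ is for |r − s|, the other for the step τ n.
  refine ⟨δ / 2, by positivity, ?_⟩
  filter_upwards [hτ0.eventually (gt_mem_nhds (show 0 < δ / 2 by positivity))] with n hn r hr s hs h
  obtain ⟨hx, hy, -⟩ := hAb (τ n) (hτ n).1 (hτ n).2 (zs n) (hz n)
  exact (hx.prod_dist_le hy (hτ n).1 hA.le hr hs).trans_lt (hδε _ (by linarith))

end Scheme

/-! ### Lower semicontinuity of the energies -/

theorem ENNReal.liminf_add_liminf_le (u v : ℕ → ℝ≥0∞) :
    liminf u atTop + liminf v atTop ≤ liminf (fun i => u i + v i) atTop := by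
  simp only [liminf_eq_iSup_iInf_of_nat]
  rw [ENNReal.iSup_add_iSup_of_monotone]
  · refine iSup_mono fun n => le_iInf₂ fun i hi => add_le_add ?_ ?_
    · exact iInf₂_le i hi
    · exact iInf₂_le i hi
  all_goals exact fun m n hmn => le_iInf₂ fun i hi => iInf₂_le i (hmn.trans hi)

section Limit
variable {Z : Type*} [MetricSpace Z]

theorem floor_div_mul_le {τ r : ℝ} (hτ : 0 < τ) (hr : 0 ≤ r) : ⌊r / τ⌋₊ * τ ≤ r := by
  rw [← le_div_iff₀ hτ]; exact Nat.floor_le (by positivity)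

theorem lt_floor_div_add_one_mul {τ r : ℝ} (hτ : 0 < τ) : r < (⌊r / τ⌋₊ + 1) * τ := by
  rw [← div_lt_iff₀ hτ]; exact Nat.lt_floor_add_one _

theorem StepBound.tendsto_nodes {T A : ℝ} (hA : 0 < A) {τ : ℕ → ℝ} (hτ : ∀ n, 0 < τ n)
    (hτ0 : Tendsto τ atTop (𝓝 0)) {us : ℕ → ℝ → Z} (hs : ∀ n, StepBound T (τ n) A (us n))
    {r : ℝ} (hr : r ∈ Icc 0 T) {w : Z} (hw : Tendsto (fun n => us n r) atTop (𝓝 w))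
    {s : ℕ → ℝ} (hs0 : ∀ᶠ n in atTop, s n ∈ Icc 0 T) (hsr : ∀ n, |r - s n| ≤ τ n) :
    Tendsto (fun n => us n (s n)) atTop (𝓝 w) := by
  refine hw.congr_dist (squeeze_zero' (Eventually.of_forall fun _ => dist_nonneg)
    (g := fun n => 3 * √(A * (2 * τ n))) (hs0.mono fun n hn => ?_) ?_)
  · refine ((hs n).dist_le (hτ n) hA.le hr hn).trans ?_
    have := hsr n
    gcongr; linarith
  · have hc : Continuous fun h : ℝ => 3 * √(A * (2 * h)) := by fun_prop
    have h0 := (hc.tendsto 0).comp hτ0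
    simpa [Function.comp_def] using h0

/-- Take for e(r) the lower limit of the energy spent by the nodes between a and r. The discrete
increment over [s, t] dominates the squared distance of the end nodes divided by t − s + τ, which
converges, so superadditivity of the lower limit transfers the bound. No further subsequence is
needed. -/
theorem StepBound.exists_energy {T A : ℝ} (hA : 0 < A) {τ : ℕ → ℝ} (hτ : ∀ n, 0 < τ n)
    (hτ0 : Tendsto τ atTop (𝓝 0)) {us : ℕ → ℝ → Z} (hs : ∀ n, StepBound T (τ n) A (us n))
    {u : ℝ → Z} (hu : ∀ r ∈ Icc 0 T, Tendsto (fun n => us n r) atTop (𝓝 (u r)))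
    {a b : ℝ} (ha : 0 ≤ a) (hb : b ≤ T) :
    ∃ e : ℝ → ℝ, MonotoneOn e (Icc a b) ∧
      (∀ s ∈ Icc a b, ∀ t ∈ Icc a b, s ≤ t → dist (u s) (u t) ^ 2 ≤ (t - s) * (e t - e s)) ∧
      ENNReal.ofReal (e b - e a) ≤ liminf (fun n => ENNReal.ofReal
        (∑ k ∈ Finset.Ico ⌊a / τ n⌋₊ ⌊b / τ n⌋₊,
          dist (nodes (τ n) (us n) k) (nodes (τ n) (us n) (k + 1)) ^ 2 / τ n)) atTop := by
  set K : ℕ → ℝ → ℕ := fun n r => ⌊r / τ n⌋₊ with hK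
  have hKm : ∀ n r s, r ≤ s → K n r ≤ K n s := fun n r s h =>
    Nat.floor_mono (div_le_div_of_nonneg_right h (hτ n).le)
  set d : ℕ → ℕ → ℝ := fun n k =>
    dist (nodes (τ n) (us n) k) (nodes (τ n) (us n) (k + 1)) ^ 2 / τ n with hd
  have hd0 : ∀ n k, 0 ≤ d n k := fun n k => div_nonneg (sq_nonneg _) (hτ n).le
  set E : ℝ → ℕ → ℝ := fun r n => ∑ k ∈ Finset.Ico (K n a) (K n r), d n k with hE
  have hE0 : ∀ r n, 0 ≤ E r n := fun r n => Finset.sum_nonneg fun k _ => hd0 n k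
  have hsum : ∀ r ∈ Icc a b, ∀ n (m : ℕ), ∑ k ∈ Finset.Ico m (K n r), d n k ≤ A := by
    intro r hr n m
    simp only [hd]
    rw [← Finset.sum_div, div_le_iff₀ (hτ n)]
    exact (hs n).sum_Ico m ((floor_div_mul_le (hτ n) (ha.trans hr.1)).trans (hr.2.trans hb))
  have hEA : ∀ r ∈ Icc a b, ∀ n, E r n ≤ A := fun r hr n => hsum r hr n _
  have hstep : ∀ s ∈ Icc a b, ∀ t ∈ Icc a b, s ≤ t → ∀ n, E s n +
      dist (nodes (τ n) (us n) (K n s)) (nodes (τ n) (us n) (K n t)) ^ 2 / (t - s + τ n) ≤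
        E t n := by
    intro s hs' t ht hst n
    have h1 : E t n = E s n + ∑ k ∈ Finset.Ico (K n s) (K n t), d n k :=
      (Finset.sum_Ico_consecutive _ (hKm n _ _ hs'.1) (hKm n _ _ hst)).symm
    have hpos : 0 < t - s + τ n := by linarith [hτ n]
    rw [h1]
    gcongr
    rw [div_le_iff₀ hpos]
    refine (sq_dist_le_mul_sum_Ico _ (hKm n _ _ hst)).trans ?_
    have h2 : ∑ k ∈ Finset.Ico (K n s) (K n t),
        dist (nodes (τ n) (us n) k) (nodes (τ n) (us n) (k + 1)) ^ 2 =
        τ n * ∑ k ∈ Finset.Ico (K n s) (K n t), d n k := by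
      rw [Finset.mul_sum]
      refine Finset.sum_congr rfl fun k _ => ?_
      have := (hτ n).ne'
      simp only [hd]; field_simp
    -- Rounding both times down can lengthen the interval by at most one step.
    have h3 : ((K n t : ℝ) - K n s) * τ n ≤ t - s + τ n := by
      have h4 := floor_div_mul_le (hτ n) (ha.trans ht.1)
      have h5 := lt_floor_div_add_one_mul (r := s) (hτ n)
      simp only [hK]; nlinarith
    rw [h2, ← mul_assoc, mul_comm _ (t - s + τ n)]
    gcongr
    exact Finset.sum_nonneg fun k _ => hd0 n k
  have hbl : ∀ r, IsBoundedUnder (· ≥ ·) atTop (E r) := fun r =>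
    isBoundedUnder_of ⟨0, hE0 r⟩
  have hbu : ∀ r ∈ Icc a b, IsBoundedUnder (· ≤ ·) atTop (E r) := fun r hr =>
    isBoundedUnder_of ⟨A, hEA r hr⟩
  have hnode : ∀ s ∈ Icc a b,
      Tendsto (fun n => nodes (τ n) (us n) (K n s)) atTop (𝓝 (u s)) := by
    intro s hs'
    have hsT : s ∈ Icc 0 T := ⟨ha.trans hs'.1, hs'.2.trans hb⟩
    refine StepBound.tendsto_nodes hA hτ hτ0 hs hsT (hu s hsT) (s := fun n => K n s * τ n)
      (Eventually.of_forall fun n => ⟨mul_nonneg (Nat.cast_nonneg _) (hτ n).le,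
        (floor_div_mul_le (hτ n) hsT.1).trans hsT.2⟩) fun n => ?_
    have h1 := floor_div_mul_le (hτ n) hsT.1
    have h2 := lt_floor_div_add_one_mul (r := s) (hτ n)
    rw [abs_of_nonneg (sub_nonneg.2 h1)]; linarith
  set e : ℝ → ℝ := fun r => liminf (E r) atTop with he
  have hkey : ∀ s ∈ Icc a b, ∀ t ∈ Icc a b, s < t →
      e s + dist (u s) (u t) ^ 2 / (t - s) ≤ e t := by
    intro s hs' t ht hst
    set c : ℕ → ℝ := fun n =>
      dist (nodes (τ n) (us n) (K n s)) (nodes (τ n) (us n) (K n t)) ^ 2 / (t - s + τ n) with hc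
    have hclim : Tendsto c atTop (𝓝 (dist (u s) (u t) ^ 2 / (t - s))) := by
      refine Tendsto.div (((hnode s hs').dist (hnode t ht)).pow 2) ?_ (sub_pos.2 hst).ne'
      simpa using tendsto_const_nhds.add hτ0
    calc e s + dist (u s) (u t) ^ 2 / (t - s) = liminf (E s) atTop + liminf c atTop := by
          rw [hclim.liminf_eq]
      _ ≤ liminf (E s + c) atTop := le_liminf_add (hbl s) (hbu s hs') hclim.isBoundedUnder_ge
          hclim.isCoboundedUnder_ge
      _ ≤ e t := by
          refine liminf_le_liminf (Eventually.of_forall fun n => hstep s hs' t ht hst.le n) ?_ ?_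
          · exact isBoundedUnder_of ⟨0, fun n => add_nonneg (hE0 s n)
              (div_nonneg (sq_nonneg _) (by linarith [hτ n]))⟩
          · exact (hbu t ht).isCoboundedUnder_ge
  refine ⟨e, ?_, ?_, ?_⟩
  · intro s hs' t ht hst
    rcases hst.eq_or_lt with rfl | hst
    · exact le_rfl
    · have h1 := hkey s hs' t ht hst
      have h2 : 0 ≤ dist (u s) (u t) ^ 2 / (t - s) :=
        div_nonneg (sq_nonneg _) (sub_pos.2 hst).le
      linarith
  · intro s hs' t ht hst
    rcases hst.eq_or_lt with rfl | hst
    · simp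
    · have h1 := hkey s hs' t ht hst
      have h2 := sub_pos.2 hst
      have h3 : dist (u s) (u t) ^ 2 / (t - s) ≤ e t - e s := by linarith
      rw [div_le_iff₀ h2] at h3
      linarith
  · rcases lt_or_ge b a with hab | hab
    · have h0 : ∀ n, E b n = 0 := fun n => by
        simp only [hE]; rw [Finset.Ico_eq_empty_of_le (hKm n _ _ hab.le)]; simp
      have h1 : ∀ n, E a n = 0 := fun n => by simp [hE]
      have : e b - e a = 0 := by simp only [he]; rw [funext h0, funext h1]; simp
      rw [this]; simp
    have hea : e a = 0 := by
      have h1 : ∀ n, E a n = 0 := fun n => by simp [hE]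
      simp only [he]; rw [funext h1]; simp
    rw [hea, sub_zero]
    have := (ENNReal.ofReal_mono).map_liminf_of_continuousAt (F := atTop) (E b)
      ENNReal.continuous_ofReal.continuousAt
      (hbu b (right_mem_Icc.2 hab)).isCoboundedUnder_ge (hbl b)
    exact this.le

theorem LowerSemicontinuous.le_liminf_comp {W : Type*} [TopologicalSpace W] {f : W → ℝ≥0∞}
    (hf : LowerSemicontinuous f) {p : ℕ → W} {w : W} (hp : Tendsto p atTop (𝓝 w)) {g : ℕ → ℝ≥0∞}
    (hg : ∀ n, f (p n) ≤ g n) : f w ≤ liminf g atTop :=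
  calc f w ≤ liminf f (𝓝 w) := LowerSemicontinuousAt.le_liminf (hf w)
    _ ≤ liminf f (map p atTop) := liminf_le_liminf_of_le hp
    _ = liminf (fun n => f (p n)) atTop := rfl
    _ ≤ liminf g atTop := liminf_le_liminf (Eventually.of_forall hg)

theorem ENNReal.liminf_sq (g : ℕ → ℝ≥0∞) :
    liminf g atTop ^ 2 = liminf (fun n => g n ^ 2) atTop :=
  (show Monotone fun x : ℝ≥0∞ => x ^ 2 from fun _ _ h => pow_le_pow_left' h 2
    ).map_liminf_of_continuousAt g (ENNReal.continuous_pow 2).continuousAt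

/-- Fatou's lemma on intervals whose ends converge to those of `[a, b]`. -/
theorem lintegral_le_liminf_of_floor {τ : ℕ → ℝ} (hτ : ∀ n, 0 < τ n)
    (hτ0 : Tendsto τ atTop (𝓝 0)) {a b : ℝ} (ha : 0 ≤ a) (S : ℝ → ℝ≥0∞) (g : ℕ → ℝ → ℝ≥0∞)
    (hS : ∀ r ∈ Ioo a b, S r ≤ liminf (fun n => g n r) atTop)
    (hg : ∀ n (c d : ℝ), 0 ≤ c → AEMeasurable (g n) (volume.restrict (Ioc c d))) :
    ∫⁻ r in Icc a b, S r ≤ liminf (fun n =>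
      ∫⁻ r in Ioc (⌊a / τ n⌋₊ * τ n) (⌊b / τ n⌋₊ * τ n), g n r) atTop := by
  set I : ℕ → Set ℝ := fun n => Ioc (⌊a / τ n⌋₊ * τ n) (⌊b / τ n⌋₊ * τ n) with hI
  rw [Measure.restrict_congr_set (Ioo_ae_eq_Icc (μ := volume) (a := a) (b := b)).symm]
  calc ∫⁻ r in Ioo a b, S r ≤ ∫⁻ r in Ioo a b, liminf (fun n => (I n).indicator (g n) r) atTop := by
        -- The rounded intervals may stop short of b, but every r < b eventually lies in them. Only
        -- the `g n` need be measurable, not `S`.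
        refine setLIntegral_mono' measurableSet_Ioo fun r hr => (hS r hr).trans (le_of_eq ?_)
        refine liminf_congr ?_
        filter_upwards [hτ0.eventually (gt_mem_nhds (sub_pos.2 hr.2))] with n hn
        rw [indicator_of_mem]
        have h1 := floor_div_mul_le (hτ n) ha
        have h2 := lt_floor_div_add_one_mul (r := b) (hτ n)
        exact ⟨h1.trans_lt hr.1, by linarith⟩
    _ ≤ ∫⁻ r, liminf (fun n => (I n).indicator (g n) r) atTop := setLIntegral_le_lintegral _ _
    _ ≤ liminf (fun n => ∫⁻ r, (I n).indicator (g n) r) atTop := by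
        refine lintegral_liminf_le' fun n => ?_
        rw [aemeasurable_indicator_iff measurableSet_Ioc]
        exact hg n _ _ (mul_nonneg (Nat.cast_nonneg _) (hτ n).le)
    _ = _ := by
        simp only [lintegral_indicator measurableSet_Ioc, hI]

/-- The kinetic energy of two curves is at most the sum of the increments of their energies. -/
theorem lintegral_metricDeriv_sq_add_le {W : Type*} [MetricSpace W] {u : ℝ → Z} {v : ℝ → W}
    {e f : ℝ → ℝ} {a b : ℝ} (hab : a ≤ b)
    (he : MonotoneOn e (Icc a b)) (hf : MonotoneOn f (Icc a b))
    (hu : ∀ s ∈ Icc a b, ∀ t ∈ Icc a b, s ≤ t →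
      dist (u s) (u t) ^ 2 ≤ (t - s) * (e t - e s))
    (hv : ∀ s ∈ Icc a b, ∀ t ∈ Icc a b, s ≤ t →
      dist (v s) (v t) ^ 2 ≤ (t - s) * (f t - f s)) :
    ∫⁻ r in Icc a b, (metricDeriv u r ^ 2 + metricDeriv v r ^ 2) ≤
      ENNReal.ofReal (e b - e a) + ENNReal.ofReal (f b - f a) :=
  calc ∫⁻ r in Icc a b, (metricDeriv u r ^ 2 + metricDeriv v r ^ 2) ≤
        -- The integral is split only after passing to these measurable majorants, since the metric
        -- derivatives are not known to be measurable here.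
        ∫⁻ r in Icc a b, (ENNReal.ofReal (deriv e r) + ENNReal.ofReal (deriv f r)) := by
        refine lintegral_mono_ae ?_
        filter_upwards [ae_metricDeriv_sq_le he hu, ae_metricDeriv_sq_le hf hv] with r h1 h2
        exact add_le_add h1 h2
    _ = _ := lintegral_add_left (measurable_deriv e).ennreal_ofReal _
    _ ≤ _ := add_le_add
        (he.lintegral_le_of_hasDerivAt hab _ fun _ _ _ h => by rw [h.deriv])
        (hf.lintegral_le_of_hasDerivAt hab _ fun _ _ _ h => by rw [h.deriv])

theorem IsACCurve.prodMk {W : Type*} [MetricSpace W] {z : ℝ → Z × W} {a b : ℝ}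
    (hu : IsACCurve (fun t => (z t).1) a b) (hv : IsACCurve (fun t => (z t).2) a b) :
    IsACCurve z a b := by
  obtain ⟨f, hf, hf'⟩ := hu
  obtain ⟨g, hg, hg'⟩ := hv
  refine ⟨fun r => |f r| + |g r|, hf.abs.add hg.abs, fun s t has hst htb => ?_⟩
  have hsub : Icc s t ⊆ Icc a b := Icc_subset_Icc has htb
  have hfi := (intervalIntegrable_iff_integrableOn_Icc_of_le hst.le).2 (hf.mono_set hsub)
  have hgi := (intervalIntegrable_iff_integrableOn_Icc_of_le hst.le).2 (hg.mono_set hsub)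
  refine max_le ((hf' s t has hst htb).trans ?_) ((hg' s t has hst htb).trans ?_)
  · refine intervalIntegral.integral_mono_on hst.le hfi (hfi.abs.add hgi.abs) fun r _ => ?_
    have := le_abs_self (f r)
    have := abs_nonneg (g r)
    linarith
  · refine intervalIntegral.integral_mono_on hst.le hgi (hfi.abs.add hgi.abs) fun r _ => ?_
    have := le_abs_self (g r)
    have := abs_nonneg (f r)
    linarith

theorem IsACCurve.mono {z : ℝ → Z} {a b c d : ℝ} (h : IsACCurve z a b) (hac : a ≤ c) (hdb : d ≤ b) :
    IsACCurve z c d := by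
  obtain ⟨f, hf, hf'⟩ := h
  exact ⟨f, hf.mono_set (Icc_subset_Icc hac hdb), fun s t hs hst ht =>
    hf' s t (hac.trans hs) hst (ht.trans hdb)⟩

end Limit

/-! ### Geodesic polygons -/

section Polygon
variable {Z : Type*} [MetricSpace Z]

/-- A curve which on each cell `[a + kh, a + (k+1)h]` is a geodesic from `p k` to `p (k+1)`. -/
structure IsPolygon (a h : ℝ) (p : ℕ → Z) (γ : ℝ → Z) : Prop where
  node : ∀ k : ℕ, γ (a + k * h) = p k
  cell : ∀ k : ℕ, ∀ s ∈ Icc (a + k * h) (a + (k + 1) * h), ∀ t ∈ Icc (a + k * h) (a + (k + 1) * h),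
    dist (γ s) (γ t) = |s - t| / h * dist (p k) (p (k + 1))

theorem IsGeodesicSpace.exists_isPolygon (hZ : IsGeodesicSpace Z) (a : ℝ) {h : ℝ} (hh : 0 < h)
    (p : ℕ → Z) : ∃ γ, IsPolygon a h p γ := by
  choose G h0 h1 hG using fun k : ℕ => hZ (p k) (p (k + 1))
  set γ : ℝ → Z := fun t => G ⌊(t - a) / h⌋₊ ((t - a) / h - ⌊(t - a) / h⌋₊) with hγ
  have hcell : ∀ k : ℕ, ∀ t ∈ Icc (a + k * h) (a + (k + 1) * h), γ t = G k ((t - a) / h - k) := by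
    intro k t ht
    -- At the right end of a cell the floor already selects the next geodesic; its start is the end
    -- of the present one.
    rcases ht.2.eq_or_lt with rfl | hlt
    · have hq : (a + (k + 1) * h - a) / h = ((k + 1 : ℕ) : ℝ) := by
        push_cast; field_simp; ring
      simp only [hγ, hq, Nat.floor_natCast, sub_self, h0]
      push_cast
      rw [add_sub_cancel_left, h1]
    · have hf : ⌊(t - a) / h⌋₊ = k := by
        rw [Nat.floor_eq_iff
            (div_nonneg (by nlinarith [ht.1, (Nat.cast_nonneg k : (0 : ℝ) ≤ k)]) hh.le),
          le_div_iff₀ hh, div_lt_iff₀ hh]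
        constructor <;> linarith [ht.1]
      simp only [hγ, hf]
  refine ⟨γ, fun k => ?_, fun k s hs t ht => ?_⟩
  · rw [hcell k _ ⟨le_rfl, by nlinarith⟩]
    have hq : (a + k * h - a) / h - k = 0 := by field_simp; ring
    rw [hq, h0]
  · rw [hcell k s hs, hcell k t ht]
    have hmem : ∀ r ∈ Icc (a + k * h) (a + (k + 1) * h), (r - a) / h - k ∈ Icc (0 : ℝ) 1 := by
      intro r hr
      constructor
      · rw [sub_nonneg, le_div_iff₀ hh]; linarith [hr.1]
      · rw [sub_le_iff_le_add, div_le_iff₀ hh]; linarith [hr.2]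
    rw [hG k _ (hmem s hs) _ (hmem t ht)]
    have hq : (s - a) / h - k - ((t - a) / h - k) = (s - t) / h := by field_simp; ring
    rw [hq, abs_div, abs_of_pos hh]

variable {a h : ℝ} {p : ℕ → Z} {γ : ℝ → Z}

theorem IsPolygon.isACCurve (hγ : IsPolygon a h p γ) (hh : 0 < h) (N : ℕ) :
    IsACCurve γ a (a + N * h) := by
  -- A crude Lipschitz constant, the sum of all speeds, is enough for absolute continuity; uniform
  -- length bounds are obtained separately.
  set M := ∑ k ∈ Finset.range N, dist (p k) (p (k + 1)) / h with hM
  have hcell : ∀ k < N, ∀ s ∈ Icc (a + k * h) (a + (k + 1) * h),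
      ∀ t ∈ Icc (a + k * h) (a + (k + 1) * h), s ≤ t → dist (γ s) (γ t) ≤ M * (t - s) := by
    intro k hk s hs t ht hst
    rw [hγ.cell k s hs t ht, abs_sub_comm, abs_of_nonneg (sub_nonneg.2 hst)]
    have h1 : dist (p k) (p (k + 1)) / h ≤ M :=
      Finset.single_le_sum (f := fun k => dist (p k) (p (k + 1)) / h)
        (fun i _ => div_nonneg dist_nonneg hh.le) (Finset.mem_range.2 hk)
    calc (t - s) / h * dist (p k) (p (k + 1)) = dist (p k) (p (k + 1)) / h * (t - s) := by ring
      _ ≤ M * (t - s) := mul_le_mul_of_nonneg_right h1 (sub_nonneg.2 hst)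
  have hlip : ∀ j ≤ N, ∀ s t, a ≤ s → s ≤ t → t ≤ a + j * h → dist (γ s) (γ t) ≤ M * (t - s) := by
    intro j
    induction j with
    | zero =>
      intro _ s t has hst ht
      have : s = t := by simp at ht; linarith
      rw [this]; simp
    | succ j ih =>
      intro hj s t has hst ht
      push_cast at ht
      rcases le_or_gt t (a + j * h) with h1 | h1
      · exact ih (by omega) s t has hst h1
      · rcases le_or_gt (a + j * h) s with h2 | h2
        · exact hcell j (by omega) s ⟨h2, hst.trans ht⟩ t ⟨h1.le, ht⟩ hst
        · have h3 := ih (by omega) s _ has h2.le le_rfl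
          have h4 := hcell j (by omega) (a + j * h) ⟨le_rfl, h1.le.trans ht⟩ t ⟨h1.le, ht⟩ h1.le
          linarith [dist_triangle (γ s) (γ (a + j * h)) (γ t)]
  refine ⟨fun _ => M, integrableOn_const measure_Icc_lt_top.ne, fun s t hs hst ht => ?_⟩
  rw [intervalIntegral.integral_const, smul_eq_mul, mul_comm]
  exact hlip N le_rfl s t hs hst.le ht

theorem IsPolygon.metricDeriv_le (hγ : IsPolygon a h p γ) (hh : 0 < h) (k : ℕ) {r : ℝ}
    (hr : r ∈ Ioo (a + k * h) (a + (k + 1) * h)) :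
    metricDeriv γ r ≤ ENNReal.ofReal (dist (p k) (p (k + 1)) / h) := by
  refine limsup_le_of_le (by isBoundedDefault) ?_
  have hnear : ∀ᶠ t in 𝓝[≠] (0 : ℝ), r + t ∈ Ioo (a + k * h) (a + (k + 1) * h) := by
    refine nhdsWithin_le_nhds ?_
    have : Tendsto (fun t : ℝ => r + t) (𝓝 0) (𝓝 r) := by
      have hc : Continuous fun t : ℝ => r + t := by fun_prop
      simpa using hc.tendsto 0
    exact this.eventually (isOpen_Ioo.mem_nhds hr)
  filter_upwards [hnear, self_mem_nhdsWithin] with t ht ht0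
  have ht1 : 0 < |t| := abs_pos.2 ht0
  rw [edist_dist, ← ENNReal.ofReal_div_of_pos ht1,
    hγ.cell k _ (Ioo_subset_Icc_self ht) _ (Ioo_subset_Icc_self hr), add_sub_cancel_left]
  refine ENNReal.ofReal_le_ofReal (le_of_eq ?_)
  field_simp

theorem IsPolygon.lintegral_metricDeriv_le {W : Type*} [MetricSpace W] {q : ℕ → W} {η : ℝ → W}
    (hγ : IsPolygon a h p γ) (hη : IsPolygon a h q η) (hh : 0 < h) (N : ℕ) :
    ∫⁻ r in Icc a (a + N * h), (metricDeriv γ r + metricDeriv η r) ≤ ENNReal.ofReal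
      (∑ k ∈ Finset.range N, (dist (p k) (p (k + 1)) + dist (q k) (q (k + 1)))) := by
  induction N with
  | zero => simp
  | succ N ih =>
    have hun : Icc a (a + (N + 1 : ℕ) * h) ⊆
        Icc a (a + N * h) ∪ Icc (a + N * h) (a + (N + 1) * h) := by
      intro r hr
      rcases le_or_gt r (a + N * h) with h | h
      · exact Or.inl ⟨hr.1, h⟩
      · exact Or.inr ⟨h.le, by simpa using hr.2⟩
    rw [Finset.sum_range_succ, ENNReal.ofReal_add (by positivity) (by positivity)]
    refine (lintegral_mono_set hun).trans ((lintegral_union_le _ _ _).trans (add_le_add ih ?_))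
    rw [Measure.restrict_congr_set (Ioo_ae_eq_Icc (μ := volume)).symm]
    calc ∫⁻ r in Ioo (a + N * h) (a + (N + 1) * h), (metricDeriv γ r + metricDeriv η r)
        ≤ ∫⁻ r in Ioo (a + N * h) (a + (N + 1) * h),
          ENNReal.ofReal ((dist (p N) (p (N + 1)) + dist (q N) (q (N + 1))) / h) := by
          refine setLIntegral_mono' measurableSet_Ioo fun r hr => ?_
          rw [add_div, ENNReal.ofReal_add (by positivity) (by positivity)]
          exact add_le_add (hγ.metricDeriv_le hh N hr) (hη.metricDeriv_le hh N hr)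
      _ = _ := by
          rw [setLIntegral_const, Real.volume_Ioo, ← ENNReal.ofReal_mul (by positivity)]
          congr 1
          field_simp; ring

/-- The polygon through the nodes `K + m j`, run at half step, stays close to the curve. -/
theorem StepBound.dist_polygon_le {T τ A : ℝ} {u : ℝ → Z} (hu : StepBound T τ A u) (hτ : 0 < τ)
    (hA : 0 < A) {a b : ℝ} (ha : 0 ≤ a) (hb : b ≤ T) {K N : ℕ} (hK : K = ⌊a / τ⌋₊)
    (hN : 0 < N) (hM : K + N = ⌊b / τ⌋₊) (hh : 0 < h) (hab : a + (2 * N : ℕ) * h = b) {m : ℕ → ℕ}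
    (hm1 : ∀ j, 2 * m j ≤ j + 1) (hm2 : ∀ j, j ≤ 2 * m j + 1)
    (hm3 : ∀ j, m (j + 1) = m j ∨ m (j + 1) = m j + 1)
    (hγ : IsPolygon a h (fun j => nodes τ u (K + m j)) γ) {r : ℝ} (hr : r ∈ Icc a b) :
    dist (γ r) (u r) ≤ 4 * √(A * (6 * τ)) := by
  have hN' : (0 : ℝ) < N := by exact_mod_cast hN
  push_cast at hab
  have hab' : a ≤ b := hr.1.trans hr.2
  have hKa : K * τ ≤ a := by rw [hK]; exact floor_div_mul_le hτ ha
  have hKa' : a < (K + 1) * τ := by rw [hK]; exact lt_floor_div_add_one_mul hτ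
  have hMb : (K + N) * τ ≤ b := by
    have := floor_div_mul_le hτ (ha.trans hab'); rw [← hM] at this; exact_mod_cast this
  have hMb' : b < (K + N + 1) * τ := by
    have := lt_floor_div_add_one_mul (r := b) hτ; rw [← hM] at this; exact_mod_cast this
  have hhτ : h ≤ τ := by
    have h1 : (1 : ℝ) ≤ N := by exact_mod_cast hN
    nlinarith
  obtain ⟨j, hj, hrj⟩ : ∃ j < 2 * N, r ∈ Icc (a + j * h) (a + (j + 1) * h) := by
    have h0 : 0 ≤ (r - a) / h := div_nonneg (sub_nonneg.2 hr.1) hh.le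
    rcases hr.2.eq_or_lt with rfl | hlt
    · refine ⟨2 * N - 1, by omega, ?_⟩
      rw [Nat.cast_sub (by omega)]
      push_cast
      constructor <;> nlinarith
    · refine ⟨⌊(r - a) / h⌋₊, ?_, ?_⟩
      · rw [Nat.floor_lt h0, div_lt_iff₀ hh]; push_cast; linarith
      · have h1 := Nat.floor_le h0
        have h2 := Nat.lt_floor_add_one ((r - a) / h)
        rw [le_div_iff₀ hh] at h1
        rw [div_lt_iff₀ hh] at h2
        constructor <;> linarith
  have hjN : (j : ℝ) + 1 ≤ 2 * N := by exact_mod_cast hj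
  have hmN : m (j + 1) ≤ N := by have := hm1 (j + 1); omega
  have hmjN : m j ≤ N := by have := hm1 j; omega
  set σ : ℝ := (K + m j : ℕ) * τ with hσ
  have hσT : σ ∈ Icc 0 T := by
    refine ⟨by positivity, ?_⟩
    have : ((K + m j : ℕ) : ℝ) ≤ K + N := by exact_mod_cast Nat.add_le_add_left hmjN K
    nlinarith
  have h1 : dist (γ r) (nodes τ u (K + m j)) ≤ √(A * (6 * τ)) := by
    have e1 := hγ.node j
    have hjj : a + j * h ∈ Icc (a + j * h) (a + (j + 1) * h) := ⟨le_rfl, by nlinarith⟩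
    rw [← e1, hγ.cell j r hrj _ hjj, abs_of_nonneg (sub_nonneg.2 hrj.1)]
    have h2 : (r - (a + j * h)) / h ≤ 1 := by rw [div_le_one hh]; linarith [hrj.2]
    refine (mul_le_of_le_one_left dist_nonneg h2).trans ?_
    rcases hm3 j with h3 | h3
    · simp [h3]
    · have h4 := hu.dist_nodes_le (K := K + m j) (M := K + (m j + 1)) (by omega) (by
        have : ((K + (m j + 1) : ℕ) : ℝ) ≤ K + N := by exact_mod_cast by omega
        nlinarith)
      simp only [h3]
      refine h4.trans (Real.sqrt_le_sqrt ?_)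
      push_cast
      nlinarith
  have h2 : dist (u σ) (u r) ≤ 3 * √(A * (6 * τ)) := by
    refine (hu.dist_le hτ hA.le hσT ⟨ha.trans hr.1, hr.2.trans hb⟩).trans ?_
    refine mul_le_mul_of_nonneg_left (Real.sqrt_le_sqrt (mul_le_mul_of_nonneg_left ?_ hA.le))
      (by norm_num)
    have e1 : (2 : ℝ) * m j ≤ j + 1 := by exact_mod_cast hm1 j
    have e2 : (j : ℝ) ≤ 2 * m j + 1 := by exact_mod_cast hm2 j
    -- The polygon is stretched to fill [a, b], so h differs slightly from τ/2. The drift is linear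
    -- in j and worst at j = 2N, where it is the mismatch between N·τ and b − a.
    have e3 : |(j : ℝ) * (τ / 2 - h)| ≤ τ := by
      have e4 : |(2 * N : ℝ) * (τ / 2 - h)| ≤ τ := by
        rw [abs_le]; constructor <;> nlinarith
      rw [abs_mul] at e4 ⊢
      refine le_trans (mul_le_mul_of_nonneg_right ?_ (abs_nonneg _)) e4
      rw [abs_of_nonneg (by positivity), abs_of_nonneg (by positivity)]; linarith
    rw [abs_le] at e3
    have e5 : |σ - r| ≤ 5 * τ := by
      rw [hσ, abs_le]; push_cast
      constructor <;> nlinarith [hrj.1, hrj.2]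
    linarith
  have := dist_triangle (γ r) (u σ) (u r)
  have h3 : dist (γ r) (u σ) ≤ √(A * (6 * τ)) := h1
  linarith

end Polygon

/-- The division of `[a, b]` into `n` equal parts. -/
noncomputable def uniformDivision (a b : ℝ) (hab : a < b) (n : ℕ) (hn : 0 < n) : Division a b where
  n := n
  t k := a + k * ((b - a) / n)
  left := by simp
  right := by
    have : (n : ℝ) ≠ 0 := by positivity
    field_simp; ring
  lt k _ := by
    have : 0 < (b - a) / n := div_pos (sub_pos.2 hab) (by positivity)
    push_cast; linarith

theorem uniformDivision_mesh_le (a b : ℝ) (hab : a < b) (n : ℕ) (hn : 0 < n) :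
    (uniformDivision a b hab n hn).mesh ≤ Real.toNNReal ((b - a) / n) := by
  refine Finset.sup_le fun k _ => Real.toNNReal_le_toNNReal (le_of_eq ?_)
  simp only [uniformDivision]
  push_cast; ring

/-- Alternating increments along a staircase are the increments of the alternating scheme. -/
theorem sum_staircase {X Y : Type*} (Cx Cy : X → Y → ℝ) (P : ℕ → X) (Q : ℕ → Y) (N : ℕ) :
    (∑ j ∈ Finset.range (2 * N), (Cx (P ((j + 1 + 1) / 2)) (Q (j / 2)) -
        Cx (P ((j + 1) / 2)) (Q (j / 2)))) +
      ∑ j ∈ Finset.range (2 * N), (Cy (P ((j + 1) / 2)) (Q ((j + 1) / 2)) -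
        Cy (P ((j + 1) / 2)) (Q (j / 2))) =
    (∑ k ∈ Finset.range N, (Cx (P (k + 1)) (Q k) - Cx (P k) (Q k))) +
      ∑ k ∈ Finset.range N, (Cy (P (k + 1)) (Q (k + 1)) - Cy (P (k + 1)) (Q k)) := by
  induction N with
  | zero => simp
  | succ N ih =>
    have e1 : 2 * (N + 1) = 2 * N + 1 + 1 := by ring
    have e2 : (2 * N + 1 + 1) / 2 = N + 1 := by omega
    have e3 : (2 * N + 1) / 2 = N := by omega
    have e4 : 2 * N / 2 = N := by omega
    have e5 : (2 * N + 1 + 1 + 1) / 2 = N + 1 := by omega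
    rw [e1]
    simp only [Finset.sum_range_succ, e2, e3, e4, e5]
    linarith

theorem sum_dist_staircase {X Y : Type*} [MetricSpace X] [MetricSpace Y] (P : ℕ → X) (Q : ℕ → Y)
    (N : ℕ) :
    (∑ j ∈ Finset.range (2 * N), (dist (P ((j + 1) / 2)) (P ((j + 1 + 1) / 2)) +
        dist (Q (j / 2)) (Q ((j + 1) / 2)))) =
    ∑ k ∈ Finset.range N, (dist (P k) (P (k + 1)) + dist (Q k) (Q (k + 1))) := by
  induction N with
  | zero => simp
  | succ N ih =>
    have e1 : 2 * (N + 1) = 2 * N + 1 + 1 := by ring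
    have e2 : (2 * N + 1 + 1) / 2 = N + 1 := by omega
    have e3 : (2 * N + 1) / 2 = N := by omega
    have e4 : 2 * N / 2 = N := by omega
    have e5 : (2 * N + 1 + 1 + 1) / 2 = N + 1 := by omega
    rw [e1]
    simp only [Finset.sum_range_succ, e2, e3, e4, e5, dist_self, ih]
    ring

/-- The node energy is at most twice the total decrease, so `ENNReal.ofReal` truncates nothing when
the node energy changes sides. -/
theorem IsProxChain.energy_add_lintegral_le {Z : Type*} [MetricSpace Z] {F : ℕ → Z → ℝ} {τ : ℝ}
    {u : ℝ → Z} (hu : IsProxChain F τ u) (hτ : 0 < τ) {K M : ℕ} (hKM : K ≤ M) :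
    ENNReal.ofReal (∑ k ∈ Finset.Ico K M, dist (nodes τ u k) (nodes τ u (k + 1)) ^ 2 / τ) +
      ∫⁻ r in Ioc (K * τ) (M * τ), stepSpeed τ u r ^ 2 ≤
    ENNReal.ofReal (2 * ∑ k ∈ Finset.Ico K M, (F k (nodes τ u k) - F k (nodes τ u (k + 1)))) := by
  have h1 := hu.lintegral_stepSpeed_le hτ hKM
  rw [Finset.sum_sub_distrib, ← Finset.mul_sum] at h1
  have h2 : 0 ≤ ∑ k ∈ Finset.Ico K M, dist (nodes τ u k) (nodes τ u (k + 1)) ^ 2 / τ :=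
    Finset.sum_nonneg fun k _ => div_nonneg (sq_nonneg _) hτ.le
  have h3 : ∑ k ∈ Finset.Ico K M, dist (nodes τ u k) (nodes τ u (k + 1)) ^ 2 / τ ≤
      2 * ∑ k ∈ Finset.Ico K M, (F k (nodes τ u k) - F k (nodes τ u (k + 1))) := by
    rw [Finset.mul_sum]
    refine Finset.sum_le_sum fun k _ => ?_
    have h4 := hu.node_le hτ k
    have h5 : dist (nodes τ u k) (nodes τ u (k + 1)) ^ 2 / (2 * τ) =
      dist (nodes τ u k) (nodes τ u (k + 1)) ^ 2 / τ / 2 := by field_simp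
    linarith
  refine (add_le_add_right h1 _).trans (le_of_eq ?_)
  rw [← ENNReal.ofReal_add h2 (sub_nonneg.2 h3), add_sub_cancel]

/-- The lower limit is superadditive and x n + (−x n) = 0; in `EReal` no finiteness has to be
checked. -/
theorem EReal.add_nonpos_of_le_liminf {u : EReal} {d : ℝ≥0∞} {x : ℕ → ℝ}
    (hu : u ≤ liminf (fun n => (x n : EReal)) atTop)
    (hd : d ≤ liminf (fun n => ENNReal.ofReal (-x n)) atTop) (hx : ∀ n, x n ≤ 0) :
    u + d ≤ 0 := by
  have h1 : (d : EReal) ≤ liminf (fun n => ((-x n : ℝ) : EReal)) atTop := by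
    have h2 : ((liminf (fun n => ENNReal.ofReal (-x n)) atTop : ℝ≥0∞) : EReal) =
        liminf (fun n => ((ENNReal.ofReal (-x n) : ℝ≥0∞) : EReal)) atTop :=
      (show Monotone ((↑) : ℝ≥0∞ → EReal) from fun _ _ => EReal.coe_ennreal_le_coe_ennreal_iff.2
        ).map_liminf_of_continuousAt _ continuous_coe_ennreal_ereal.continuousAt
    refine (EReal.coe_ennreal_le_coe_ennreal_iff.2 hd).trans (h2.le.trans (le_of_eq ?_))
    congr 1
    funext n
    rw [EReal.coe_ennreal_ofReal, max_eq_left (neg_nonneg.2 (hx n))]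
  calc
    u + d ≤ liminf (fun n => (x n : EReal)) atTop + liminf (fun n => ((-x n : ℝ) : EReal)) atTop :=
        add_le_add hu h1
    _ ≤ liminf ((fun n => (x n : EReal)) + fun n => ((-x n : ℝ) : EReal)) atTop :=
        EReal.le_liminf_add
    _ = liminf (fun _ : ℕ => (0 : EReal)) atTop := by
        congr 1
        funext n
        rw [Pi.add_apply, ← EReal.coe_add, add_neg_cancel, EReal.coe_zero]
    _ = 0 := liminf_const 0

/-! ### Passage to the limit in the energy-dissipation inequality -/

section Flow
variable {X Y : Type*} [MetricSpace X] [MetricSpace Y] {Cx Cy : X → Y → ℝ}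

omit [MetricSpace X] [MetricSpace Y] in
-- A division of a degenerate interval has no steps; the empty division also makes the filter
-- nontrivial, so that the lower limit of the constant 0 is 0.
theorem upsilon_self (z : ℝ → X × Y) (a : ℝ) : upsilon Cx Cy z a a = 0 := by
  have hn : ∀ Δ : Division a a, Δ.n = 0 := by
    intro Δ
    by_contra h
    have hmono : ∀ k ≤ Δ.n, 0 < k → a < Δ.t k := by
      intro k
      induction k with
      | zero => intro _ h; exact absurd h (lt_irrefl _)
      | succ k ih =>
        intro hk _
        have h1 := Δ.lt k (by omega)
        rcases Nat.eq_zero_or_pos k with rfl | h2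
        · rwa [Δ.left] at h1
        · exact (ih (by omega) h2).trans h1
    have := hmono Δ.n le_rfl (Nat.pos_of_ne_zero h)
    rw [Δ.right] at this
    exact lt_irrefl _ this
  have : (comap (Division.mesh (a := a) (b := a)) (𝓝 0)).NeBot := by
    refine comap_neBot fun t ht => ⟨⟨0, fun _ => a, rfl, rfl, by simp⟩, ?_⟩
    simpa [Division.mesh] using mem_of_mem_nhds ht
  have h0 : ∀ Δ : Division a a, upsilonDiv Cx Cy Δ z = 0 := fun Δ => by simp [upsilonDiv, hn Δ]
  simp only [upsilon, h0]
  exact liminf_const _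

theorem dissipation_self (z : ℝ → X × Y) (a : ℝ) : dissipation Cx Cy z a a = 0 := by
  simp [dissipation]

/-- The energy-dissipation inequality is stable under the passage to the limit. -/
theorem upsilon_add_dissipation_nonpos (hX : IsGeodesicSpace X) (hY : IsGeodesicSpace Y)
    (hslope_x : LowerSemicontinuous fun p : X × Y => metricSlope (fun u => Cx u p.2) p.1)
    (hslope_y : LowerSemicontinuous fun p : X × Y => metricSlope (fun v => Cy p.1 v) p.2)
    (hUpsilon : UpsilonLSC Cx Cy) {x₀ : X} {y₀ : Y} {T A : ℝ} (hA : 0 < A) {τ : ℕ → ℝ}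
    {zs : ℕ → ℝ → X × Y} {z : ℝ → X × Y} (hτ : ∀ n, 0 < τ n) (hτ0 : Tendsto τ atTop (𝓝 0))
    (hz : ∀ n, IsDeGiorgiCurve Cx Cy x₀ y₀ (τ n) (zs n))
    (hx : ∀ n, StepBound (T) (τ n) A fun t => (zs n t).1)
    (hy : ∀ n, StepBound (T) (τ n) A fun t => (zs n t).2)
    (hunif : TendstoUniformlyOn zs z atTop (Icc 0 T)) (hac : IsACCurve z 0 T)
    {a b : ℝ} (ha : 0 ≤ a) (hab : a < b) (hb : b ≤ T) (hτab : ∀ n, τ n < b - a) :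
    upsilon Cx Cy z a b + (dissipation Cx Cy z a b : EReal) ≤ 0 := by
  set K : ℕ → ℕ := fun n => ⌊a / τ n⌋₊ with hK
  set M : ℕ → ℕ := fun n => ⌊b / τ n⌋₊ with hM
  set N : ℕ → ℕ := fun n => M n - K n with hN
  have hKM : ∀ n, K n < M n := by
    intro n
    have h1 := floor_div_mul_le (hτ n) ha
    have h2 := lt_floor_div_add_one_mul (r := b) (hτ n)
    have h3 : (K n : ℝ) * τ n < M n * τ n := by
      simp only [hK, hM]; linarith [hτab n]
    exact_mod_cast lt_of_mul_lt_mul_right h3 (hτ n).le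
  have hN0 : ∀ n, 0 < N n := fun n => Nat.sub_pos_of_lt (hKM n)
  have hKN : ∀ n, K n + N n = M n := fun n => Nat.add_sub_cancel' (hKM n).le
  have hN2 : ∀ n, 0 < 2 * N n := fun n => Nat.mul_pos two_pos (hN0 n)
  have hMT : ∀ n, M n * τ n ≤ T := fun n =>
    (floor_div_mul_le (hτ n) (ha.trans hab.le)).trans hb
  set h : ℕ → ℝ := fun n => (b - a) / (2 * N n : ℕ) with hh
  have hh0 : ∀ n, 0 < h n := fun n => div_pos (sub_pos.2 hab) (by exact_mod_cast hN2 n)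
  have hhN : ∀ n, a + (2 * N n : ℕ) * h n = b := by
    intro n
    have : ((2 * N n : ℕ) : ℝ) ≠ 0 := by exact_mod_cast (hN2 n).ne'
    simp only [hh]; field_simp; ring
  have hhτ : ∀ n, h n ≤ τ n := by
    intro n
    simp only [hh]
    rw [div_le_iff₀ (by exact_mod_cast hN2 n)]
    have h1 := floor_div_mul_le (hτ n) ha
    have h2 := lt_floor_div_add_one_mul (r := b) (hτ n)
    have h3 : (K n : ℝ) + N n = M n := by exact_mod_cast hKN n
    have h4 : (1 : ℝ) ≤ N n := by exact_mod_cast hN0 n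
    have h5 := mul_le_mul_of_nonneg_right h4 (hτ n).le
    have h6 : (M n : ℝ) * τ n = K n * τ n + N n * τ n := by rw [← h3]; ring
    simp only [hK, hM] at h6
    push_cast
    linarith
  set P : ℕ → ℕ → X := fun n => nodes (τ n) fun t => (zs n t).1 with hP
  set Q : ℕ → ℕ → Y := fun n => nodes (τ n) fun t => (zs n t).2 with hQ
  -- The staircase: (j + 1)/2 increases on even half steps and j/2 on odd ones, so x moves first and
  -- y then moves with the new x at the left end, as in the scheme.
  choose γ hγ using fun n => hX.exists_isPolygon a (hh0 n) fun j => P n (K n + (j + 1) / 2)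
  choose η hη using fun n => hY.exists_isPolygon a (hh0 n) fun j => Q n (K n + j / 2)
  set ws : ℕ → ℝ → X × Y := fun n t => (γ n t, η n t) with hws
  set Δ : ℕ → Division a b := fun n => uniformDivision a b hab (2 * N n) (hN2 n) with hΔ
  set U : ℕ → ℝ := fun n =>
    (∑ k ∈ Finset.Ico (K n) (M n), (Cx (P n (k + 1)) (Q n k) - Cx (P n k) (Q n k))) +
      ∑ k ∈ Finset.Ico (K n) (M n),
        (Cy (P n (k + 1)) (Q n (k + 1)) - Cy (P n (k + 1)) (Q n k)) with hU
  have hUΔ : ∀ n, upsilonDiv Cx Cy (Δ n) (ws n) = U n := by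
    intro n
    have hx' : ∀ j : ℕ, γ n ((Δ n).t j) = P n (K n + (j + 1) / 2) := (hγ n).node
    have hy' : ∀ j : ℕ, η n ((Δ n).t j) = Q n (K n + j / 2) := (hη n).node
    have hn : (Δ n).n = 2 * N n := rfl
    simp only [upsilonDiv, hws, hx', hy', hn, hU, Finset.sum_Ico_eq_sum_range]
    exact sum_staircase Cx Cy (fun i => P n (K n + i)) (fun i => Q n (K n + i)) (N n)
  have hmesh : Tendsto (fun n => (Δ n).mesh) atTop (𝓝 0) := by
    have h1 : Tendsto (fun n => Real.toNNReal (τ n)) atTop (𝓝 0) := by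
      have h2 := (continuous_real_toNNReal.tendsto 0).comp hτ0
      simpa [Function.comp_def] using h2
    exact tendsto_of_tendsto_of_tendsto_of_le_of_le tendsto_const_nhds h1 (fun n => zero_le)
      fun n => (uniformDivision_mesh_le a b hab _ (hN2 n)).trans (Real.toNNReal_le_toNNReal (hhτ n))
  have hwac : ∀ n, IsACCurve (ws n) a b := by
    intro n
    have h1 := (hγ n).isACCurve (hh0 n) (2 * N n)
    have h2 := (hη n).isACCurve (hh0 n) (2 * N n)
    rw [hhN] at h1 h2
    exact IsACCurve.prodMk h1 h2
  have hwclose : ∀ n, ∀ r ∈ Icc a b, dist (ws n r) (zs n r) ≤ 4 * √(A * (6 * τ n)) := by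
    intro n r hr
    refine max_le ?_ ?_
    · exact (hx n).dist_polygon_le (hτ n) hA ha hb (K := K n) (N := N n) rfl (hN0 n) (hKN n)
        (hh0 n) (hhN n) (m := fun j => (j + 1) / 2) (fun j => by omega) (fun j => by omega)
        (fun j => by omega) (hγ n) hr
    · exact (hy n).dist_polygon_le (hτ n) hA ha hb (K := K n) (N := N n) rfl (hN0 n) (hKN n)
        (hh0 n) (hhN n) (m := fun j => j / 2) (fun j => by omega) (fun j => by omega)
        (fun j => by omega) (hη n) hr
  have hwunif : TendstoUniformlyOn ws z atTop (Icc a b) := by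
    have h1 : Tendsto (fun n => 4 * √(A * (6 * τ n))) atTop (𝓝 0) := by
      have hc : Continuous fun h : ℝ => 4 * √(A * (6 * h)) := by fun_prop
      have h0 := (hc.tendsto 0).comp hτ0
      simpa [Function.comp_def] using h0
    rw [Metric.tendstoUniformlyOn_iff] at hunif ⊢
    intro ε hε
    filter_upwards [hunif (ε / 2) (by positivity),
      h1.eventually (gt_mem_nhds (show 0 < ε / 2 by positivity))] with n h2 h3 r hr
    have h4 := h2 r ⟨ha.trans hr.1, hr.2.trans hb⟩
    have h5 := hwclose n r hr
    rw [dist_comm] at h5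
    linarith [dist_triangle (z r) (zs n r) (ws n r)]
  have hlen : (⨆ n, ∫⁻ t in Icc a b, (metricDeriv (fun r => (ws n r).1) t +
      metricDeriv (fun r => (ws n r).2) t)) < ⊤ := by
    refine lt_of_le_of_lt (iSup_le fun n => ?_) (ENNReal.ofReal_lt_top (r := A + T))
    have h1 := (hγ n).lintegral_metricDeriv_le (hη n) (hh0 n) (2 * N n)
    rw [hhN] at h1
    refine h1.trans (ENNReal.ofReal_le_ofReal ?_)
    have h2 := sum_dist_staircase (fun i => P n (K n + i)) (fun i => Q n (K n + i)) (N n)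
    refine (le_of_eq h2).trans ?_
    have h3 := (hx n).sum_Ico (K n) (hMT n)
    have h4 := (hy n).sum_Ico (K n) (hMT n)
    rw [Finset.sum_Ico_eq_sum_range] at h3 h4
    -- Converts the energy bound into a length bound: the first terms sum to at most A over both
    -- coordinates, and the second to N·τ ≤ T.
    have h5 : ∀ d : ℝ, d ≤ (d ^ 2 / τ n + τ n) / 2 := by
      intro d
      have h6 := (hτ n).ne'
      have e : (d ^ 2 / τ n + τ n) / 2 - d = (d - τ n) ^ 2 / (2 * τ n) := by
        field_simp; ring
      have : 0 ≤ (d - τ n) ^ 2 / (2 * τ n) := div_nonneg (sq_nonneg _) (by linarith [hτ n])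
      linarith
    calc ∑ k ∈ Finset.range (N n), (dist (P n (K n + k)) (P n (K n + (k + 1))) +
          dist (Q n (K n + k)) (Q n (K n + (k + 1))))
        ≤ ∑ k ∈ Finset.range (N n),
          ((dist (P n (K n + k)) (P n (K n + (k + 1))) ^ 2 / τ n + τ n) / 2 +
          (dist (Q n (K n + k)) (Q n (K n + (k + 1))) ^ 2 / τ n + τ n) / 2) :=
          Finset.sum_le_sum fun k _ => add_le_add (h5 _) (h5 _)
      _ = (∑ k ∈ Finset.range (N n), dist (P n (K n + k)) (P n (K n + (k + 1))) ^ 2) / τ n / 2 +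
          (∑ k ∈ Finset.range (N n), dist (Q n (K n + k)) (Q n (K n + (k + 1))) ^ 2) / τ n / 2 +
            N n * τ n := by
          rw [Finset.sum_div, Finset.sum_div, Finset.sum_div, Finset.sum_div,
            ← Finset.sum_add_distrib, ← nsmul_eq_mul, ← Finset.card_range (N n),
            ← Finset.sum_const, Finset.card_range, ← Finset.sum_add_distrib]
          refine Finset.sum_congr rfl fun k _ => by ring
      _ ≤ A / 2 + A / 2 + T := by
          have e1 := (div_le_iff₀ (hτ n)).2 h3
          have e2 := (div_le_iff₀ (hτ n)).2 h4
          have e3 : (N n : ℝ) * τ n ≤ T := by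
            refine le_trans (mul_le_mul_of_nonneg_right ?_ (hτ n).le) (hMT n)
            exact_mod_cast Nat.sub_le _ _
          refine add_le_add (add_le_add ?_ ?_) e3
          · exact div_le_div_of_nonneg_right e1 zero_le_two
          · exact div_le_div_of_nonneg_right e2 zero_le_two
      _ = A + T := by ring
  have hups := hUpsilon a b hab.le z (hac.mono ha hb) Δ ws hmesh hwac hwunif hlen
  simp only [hUΔ] at hups
  have hfst : ∀ r ∈ Icc 0 T, Tendsto (fun n => (zs n r).1) atTop (𝓝 (z r).1) := fun r hr =>
    (continuous_fst.tendsto _).comp (hunif.tendsto_at hr)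
  have hsnd : ∀ r ∈ Icc 0 T, Tendsto (fun n => (zs n r).2) atTop (𝓝 (z r).2) := fun r hr =>
    (continuous_snd.tendsto _).comp (hunif.tendsto_at hr)
  obtain ⟨e, he, hed, hel⟩ := StepBound.exists_energy hA hτ hτ0 hx hfst ha hb
  obtain ⟨f, hf, hfd, hfl⟩ := StepBound.exists_energy hA hτ hτ0 hy hsnd ha hb
  have hkin := (lintegral_metricDeriv_sq_add_le hab.le he hf hed hfd).trans
    ((add_le_add hel hfl).trans (ENNReal.liminf_add_liminf_le _ _))
  -- The frozen x is taken at the right end of the cell, where the bounds on [0, T] apply only if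
  -- that end has not passed T; this holds for small steps because r < b.
  have hcellT : ∀ r ∈ Ioo a b, ∀ᶠ n in atTop, (cellIndex (τ n) r + 1) * τ n ≤ T := by
    intro r hr
    filter_upwards [hτ0.eventually (gt_mem_nhds (sub_pos.2 hr.2))] with n hn
    have h1 := (mem_cell (hτ n) (ha.trans_lt hr.1)).1
    linarith
  have hsl : ∀ r ∈ Ioo a b, metricSlope (fun u => Cx u (z r).2) (z r).1 ^ 2 +
      metricSlope (fun v => Cy (z r).1 v) (z r).2 ^ 2 ≤
      liminf (fun n => stepSpeed (τ n) (fun t => (zs n t).1) r ^ 2 +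
        stepSpeed (τ n) (fun t => (zs n t).2) r ^ 2) atTop := by
    intro r hr
    have hr0 : 0 < r := ha.trans_lt hr.1
    have hrT : r ∈ Icc 0 T := ⟨hr0.le, hr.2.le.trans hb⟩
    have hq : Tendsto (fun n => (zs n (cellIndex (τ n) r * τ n)).2) atTop (𝓝 (z r).2) := by
      refine StepBound.tendsto_nodes hA hτ hτ0 hy hrT (hsnd r hrT)
        (s := fun n => cellIndex (τ n) r * τ n) ?_ fun n => ?_
      · filter_upwards [hcellT r hr] with n hn
        exact ⟨mul_nonneg (Nat.cast_nonneg _) (hτ n).le, by linarith [hτ n]⟩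
      · have h1 := mem_cell (hτ n) hr0
        rw [abs_of_nonneg (sub_nonneg.2 h1.1.le)]; linarith [h1.2]
    have hp : Tendsto (fun n => (zs n ((cellIndex (τ n) r + 1) * τ n)).1) atTop (𝓝 (z r).1) := by
      refine StepBound.tendsto_nodes hA hτ hτ0 hx hrT (hfst r hrT)
        (s := fun n => (cellIndex (τ n) r + 1) * τ n) ?_ fun n => ?_
      · filter_upwards [hcellT r hr] with n hn
        exact ⟨mul_nonneg (by positivity) (hτ n).le, hn⟩
      · have h1 := mem_cell (hτ n) hr0
        rw [abs_of_nonpos (sub_nonpos.2 h1.2)]; linarith [h1.1]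
    -- The slopes are evaluated at mixed points, one coordinate at time r and the other at an end of
    -- the cell. Both converge to z r, so joint lower semicontinuity is what is needed.
    have h1 := hslope_x.le_liminf_comp (((hfst r hrT).prodMk_nhds hq))
      fun n => (hz n).chain_fst.metricSlope_le (hτ n) hr0
    have h2 := hslope_y.le_liminf_comp (hp.prodMk_nhds (hsnd r hrT))
      (g := fun n => stepSpeed (τ n) (fun t => (zs n t).2) r) fun n => by
      have h3 := (hz n).chain_snd.metricSlope_le (hτ n) hr0
      simp only [nodes_succ] at h3
      exact h3
    refine le_trans (add_le_add (pow_le_pow_left' h1 2) (pow_le_pow_left' h2 2)) ?_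
    rw [ENNReal.liminf_sq, ENNReal.liminf_sq]
    exact ENNReal.liminf_add_liminf_le _ _
  have hslope := lintegral_le_liminf_of_floor hτ hτ0 ha (b := b) _ _ hsl fun n c d hc =>
    (((hz n).chain_fst.aemeasurable_stepSpeed (hτ n) c hc d).pow_const 2).add
      (((hz n).chain_snd.aemeasurable_stepSpeed (hτ n) c hc d).pow_const 2)
  have hscheme : ∀ n, ENNReal.ofReal (∑ k ∈ Finset.Ico (K n) (M n),
        dist (P n k) (P n (k + 1)) ^ 2 / τ n) +
      ENNReal.ofReal (∑ k ∈ Finset.Ico (K n) (M n), dist (Q n k) (Q n (k + 1)) ^ 2 / τ n) +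
      ∫⁻ r in Ioc (K n * τ n) (M n * τ n), (stepSpeed (τ n) (fun t => (zs n t).1) r ^ 2 +
        stepSpeed (τ n) (fun t => (zs n t).2) r ^ 2) ≤ ENNReal.ofReal (2 * -U n) ∧ U n ≤ 0 := by
    intro n
    have h1 := (hz n).chain_fst.energy_add_lintegral_le (hτ n) (hKM n).le
    have h2 := (hz n).chain_snd.energy_add_lintegral_le (hτ n) (hKM n).le
    have hSx : 0 ≤ ∑ k ∈ Finset.Ico (K n) (M n), (Cx (P n k) (Q n k) - Cx (P n (k + 1)) (Q n k)) :=
      Finset.sum_nonneg fun k _ => by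
        have h3 := (hz n).chain_fst.node_le (hτ n) k
        have h4 : 0 ≤ dist (P n k) (P n (k + 1)) ^ 2 / (2 * τ n) :=
          div_nonneg (sq_nonneg _) (by linarith [hτ n])
        simp only [hP, hQ] at h4 ⊢
        linarith
    have hSy : 0 ≤ ∑ k ∈ Finset.Ico (K n) (M n),
        (Cy (P n (k + 1)) (Q n k) - Cy (P n (k + 1)) (Q n (k + 1))) :=
      Finset.sum_nonneg fun k _ => by
        have h3 := (hz n).chain_snd.node_le (hτ n) k
        have h4 : 0 ≤ dist (Q n k) (Q n (k + 1)) ^ 2 / (2 * τ n) :=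
          div_nonneg (sq_nonneg _) (by linarith [hτ n])
        simp only [hP, hQ] at h4 ⊢
        linarith
    have hUS : -U n =
        (∑ k ∈ Finset.Ico (K n) (M n), (Cx (P n k) (Q n k) - Cx (P n (k + 1)) (Q n k)))
        + ∑ k ∈ Finset.Ico (K n) (M n),
          (Cy (P n (k + 1)) (Q n k) - Cy (P n (k + 1)) (Q n (k + 1))) := by
      simp only [hU, Finset.sum_sub_distrib]; ring
    refine ⟨?_, by linarith⟩
    have hmeas := ((hz n).chain_fst.aemeasurable_stepSpeed (hτ n) (K n * τ n)
      (mul_nonneg (Nat.cast_nonneg _) (hτ n).le) (M n * τ n)).pow_const 2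
    rw [lintegral_add_left' hmeas, hUS, mul_add, ENNReal.ofReal_add (by positivity) (by positivity),
      add_add_add_comm]
    exact add_le_add h1 h2
  refine EReal.add_nonpos_of_le_liminf hups ?_ fun n => (hscheme n).2
  rw [dissipation, ← mul_add]
  have hsum := (add_le_add hkin hslope).trans (ENNReal.liminf_add_liminf_le _ _)
  calc _ ≤ 1 / 2 * liminf (fun n => ENNReal.ofReal (2 * -U n)) atTop := by
        gcongr
        exact hsum.trans (liminf_le_liminf (Eventually.of_forall fun n => (hscheme n).1))
    _ = liminf (fun n => 1 / 2 * ENNReal.ofReal (2 * -U n)) atTop :=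
        (show Monotone fun x : ℝ≥0∞ => 1 / 2 * x from fun _ _ h => mul_le_mul_right h _
          ).map_liminf_of_continuousAt _ (ENNReal.continuous_const_mul (by simp)).continuousAt
    _ = _ := by
        congr 1
        funext n
        rw [ENNReal.ofReal_mul zero_le_two, ← mul_assoc, ENNReal.ofReal_ofNat, one_div,
          ENNReal.inv_mul_cancel (by simp) (by simp), one_mul]

/-- Uniform limits of discrete curves are EDI equilibrium flows. -/
theorem IsEDIFlow.of_tendstoUniformlyOn (hX : IsGeodesicSpace X) (hY : IsGeodesicSpace Y)
    (hslope_x : LowerSemicontinuous fun p : X × Y => metricSlope (fun u => Cx u p.2) p.1)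
    (hslope_y : LowerSemicontinuous fun p : X × Y => metricSlope (fun v => Cy p.1 v) p.2)
    (hUpsilon : UpsilonLSC Cx Cy) {x₀ : X} {y₀ : Y} {T A : ℝ} (hT : 0 < T) (hA : 0 < A)
    {τ : ℕ → ℝ} {zs : ℕ → ℝ → X × Y} {z : ℝ → X × Y} (hτ : ∀ n, 0 < τ n)
    (hτ0 : Tendsto τ atTop (𝓝 0)) (hz : ∀ n, IsDeGiorgiCurve Cx Cy x₀ y₀ (τ n) (zs n))
    (hx : ∀ n, StepBound T (τ n) A fun t => (zs n t).1)
    (hy : ∀ n, StepBound T (τ n) A fun t => (zs n t).2)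
    (hunif : TendstoUniformlyOn zs z atTop (Icc 0 T)) : IsEDIFlow Cx Cy T x₀ y₀ z := by
  have hfst : ∀ r ∈ Icc 0 T, Tendsto (fun n => (zs n r).1) atTop (𝓝 (z r).1) := fun r hr =>
    (continuous_fst.tendsto _).comp (hunif.tendsto_at hr)
  have hsnd : ∀ r ∈ Icc 0 T, Tendsto (fun n => (zs n r).2) atTop (𝓝 (z r).2) := fun r hr =>
    (continuous_snd.tendsto _).comp (hunif.tendsto_at hr)
  have hac : IsACCurve z 0 T := by
    obtain ⟨e, he, hed, -⟩ := StepBound.exists_energy hA hτ hτ0 hx hfst le_rfl le_rfl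
    obtain ⟨f, hf, hfd, -⟩ := StepBound.exists_energy hA hτ hτ0 hy hsnd le_rfl le_rfl
    exact IsACCurve.prodMk (IsACCurve.of_sq_dist_le hT.le he hed)
      (IsACCurve.of_sq_dist_le hT.le hf hfd)
  have h0T : (0 : ℝ) ∈ Icc 0 T := left_mem_Icc.2 hT.le
  have hz0 : z 0 = (x₀, y₀) := by
    have h1 := hunif.tendsto_at h0T
    simp only [(hz _).start] at h1
    exact tendsto_nhds_unique h1 tendsto_const_nhds
  -- The inequality holds from every initial time, which contains both the case t = 0 and the almost
  -- everywhere statement.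
  have hedi : ∀ a ∈ Icc 0 T, ∀ b ∈ Icc a T,
      upsilon Cx Cy z a b + (dissipation Cx Cy z a b : EReal) ≤ 0 := by
    intro a ha b hb
    rcases hb.1.eq_or_lt with rfl | hab
    · rw [upsilon_self, dissipation_self]; simp
    -- Dropping finitely many terms makes every step shorter than b − a, so the rounded interval
    -- contains at least one full step.
    · obtain ⟨m, hm⟩ := eventually_atTop.1 (hτ0.eventually (gt_mem_nhds (sub_pos.2 hab)))
      have hshift := tendsto_add_atTop_nat m
      exact upsilon_add_dissipation_nonpos hX hY hslope_x hslope_y hUpsilon hA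
        (fun n => hτ (n + m)) (hτ0.comp hshift) (fun n => hz (n + m)) (fun n => hx (n + m))
        (fun n => hy (n + m)) (fun v hv => hshift.eventually (hunif v hv)) hac ha.1 hab hb.2
        fun n => hm _ (Nat.le_add_left _ _)
  refine ⟨hac, ?_, fun s hs => hedi 0 h0T s hs, ?_⟩
  · rw [← hz0, tendsto_iff_dist_tendsto_zero]
    have hle : ∀ t ∈ Icc 0 T, dist (z t) (z 0) ≤ 3 * √(A * t) := by
      intro t ht
      have hlim : Tendsto (fun n => 3 * √(A * (|t - 0| + τ n))) atTop
          (𝓝 (3 * √(A * t))) := by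
        have hc : Continuous fun h : ℝ => 3 * √(A * (|t - 0| + h)) := by fun_prop
        have h0 := (hc.tendsto 0).comp hτ0
        simpa [Function.comp_def, abs_of_nonneg ht.1] using h0
      exact le_of_tendsto_of_tendsto' ((hunif.tendsto_at ht).dist (hunif.tendsto_at h0T)) hlim
        fun n => (hx n).prod_dist_le (hy n) (hτ n) hA.le ht h0T
    refine squeeze_zero' (Eventually.of_forall fun _ => dist_nonneg)
      (g := fun t => 3 * √(A * t)) ?_ ?_
    · filter_upwards [Ioc_mem_nhdsGT hT] with t ht using hle t ⟨ht.1.le, ht.2⟩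
    · have hc : Continuous fun t : ℝ => 3 * √(A * t) := by fun_prop
      have h0 := hc.tendsto 0
      rw [mul_zero, Real.sqrt_zero, mul_zero] at h0
      exact tendsto_nhdsWithin_of_tendsto_nhds h0
  · filter_upwards [ae_restrict_mem measurableSet_Ioc] with t ht s hs
    exact hedi t ⟨ht.1.le, ht.2⟩ s hs

end Flow

theorem theorem1 {X Y : Type*}
    [MetricSpace X] [CompleteSpace X] [TopologicalSpace.SeparableSpace X]
    [MetricSpace Y] [CompleteSpace Y] [TopologicalSpace.SeparableSpace Y]
    (hX : IsGeodesicSpace X) (hY : IsGeodesicSpace Y)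
    (Cx Cy : X → Y → ℝ)
    -- lower bound
    (C₁ : ℝ) (hbelow : ∀ x y, -C₁ ≤ Cx x y ∧ -C₁ ≤ Cy x y)
    -- existence of minimizers
    (τbar : ℝ) (hτbar : 0 < τbar)
    (hmin : ∀ τ, 0 < τ → τ ≤ τbar → ∀ (x : X) (y : Y),
      (proxSet (fun u => Cx u y) x τ).Nonempty ∧ (proxSet (fun v => Cy x v) y τ).Nonempty)
    -- compactness of bounded pieces of sublevel sets
    (hcompact : ∀ (c r : ℝ), 0 < r → ∀ (x : X) (y : Y),
      IsCompact {u : X | Cx u y ≤ c ∧ dist u x ≤ r} ∧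
      IsCompact {v : Y | Cy x v ≤ c ∧ dist v y ≤ r})
    -- lower semicontinuity of the slopes
    (hslope_x : LowerSemicontinuous fun p : X × Y => metricSlope (fun u => Cx u p.2) p.1)
    (hslope_y : LowerSemicontinuous fun p : X × Y => metricSlope (fun v => Cy p.1 v) p.2)
    -- Lipschitz dependence on the other variable
    (hLip_x : ∃ L : ℝ≥0, ∀ x, LipschitzWith L fun y => Cx x y)
    (hLip_y : ∃ L : ℝ≥0, ∀ y, LipschitzWith L fun x => Cy x y)
    -- lower semicontinuity of the variation functional
    (hUpsilon : UpsilonLSC Cx Cy)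
    (x₀ : X) (y₀ : Y) (T : ℝ) (hT : 0 < T) :
    -- all the interpolated curves with step at most `τbar` take their values in one compact set
    (∃ K : Set (X × Y), IsCompact K ∧ ∀ τ, 0 < τ → τ ≤ τbar → ∀ z : ℝ → X × Y,
      IsDeGiorgiCurve Cx Cy x₀ y₀ τ z → ∀ t ∈ Icc 0 T, z t ∈ K) ∧
    -- relative compactness for uniform convergence as the step tends to zero
    (∀ (τ : ℕ → ℝ) (zs : ℕ → ℝ → X × Y),
      (∀ n, 0 < τ n ∧ τ n ≤ τbar) → Tendsto τ atTop (𝓝 0) →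
      (∀ n, IsDeGiorgiCurve Cx Cy x₀ y₀ (τ n) (zs n)) →
      ∃ (φ : ℕ → ℕ) (z : ℝ → X × Y), StrictMono φ ∧
        TendstoUniformlyOn (fun n => zs (φ n)) z atTop (Icc 0 T)) ∧
    -- every limit curve is an EDI equilibrium flow
    (∀ (τ : ℕ → ℝ) (zs : ℕ → ℝ → X × Y) (z : ℝ → X × Y),
      (∀ n, 0 < τ n ∧ τ n ≤ τbar) → Tendsto τ atTop (𝓝 0) →
      (∀ n, IsDeGiorgiCurve Cx Cy x₀ y₀ (τ n) (zs n)) →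
      TendstoUniformlyOn zs z atTop (Icc 0 T) →
      IsEDIFlow Cx Cy T x₀ y₀ z) := by
  obtain ⟨L₁, hL₁⟩ := hLip_x
  obtain ⟨L₂, hL₂⟩ := hLip_y
  have hLx : ∀ x y y', Cx x y ≤ Cx x y' + (max L₁ L₂ : ℝ≥0) * dist y' y := by
    intro x y y'
    have h1 := (hL₁ x).dist_le_mul y y'
    have h2 : (L₁ : ℝ) * dist y y' ≤ (max L₁ L₂ : ℝ≥0) * dist y y' := by
      gcongr; exact le_max_left _ _
    rw [Real.dist_eq] at h1
    rw [dist_comm y' y]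
    linarith [le_abs_self (Cx x y - Cx x y')]
  have hLy : ∀ x x' y, Cy x y ≤ Cy x' y + (max L₁ L₂ : ℝ≥0) * dist x' x := by
    intro x x' y
    have h1 := (hL₂ y).dist_le_mul x x'
    have h2 : (L₂ : ℝ) * dist x x' ≤ (max L₁ L₂ : ℝ≥0) * dist x x' := by
      gcongr; exact le_max_right _ _
    rw [Real.dist_eq] at h1
    rw [dist_comm x' x]
    linarith [le_abs_self (Cy x y - Cy x' y)]
  have hL : (0 : ℝ) ≤ (max L₁ L₂ : ℝ≥0) := NNReal.coe_nonneg _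
  refine ⟨IsDeGiorgiCurve.exists_compact hL hbelow hcompact hLx hLy x₀ y₀,
    fun τ zs hτ hτ0 hz =>
      IsDeGiorgiCurve.exists_subseq hL hbelow hcompact hLx hLy hT τ zs hτ hτ0 hz,
    fun τ zs z hτ hτ0 hz hunif => ?_⟩
  obtain ⟨A, hA, hAb⟩ := IsDeGiorgiCurve.exists_bound hbelow hLx hLy x₀ y₀ T τbar
  exact IsEDIFlow.of_tendstoUniformlyOn hX hY hslope_x hslope_y hUpsilon hT hA
    (fun n => (hτ n).1) hτ0 hz (fun n => (hAb _ (hτ n).1 (hτ n).2 _ (hz n)).1)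
    (fun n => (hAb _ (hτ n).1 (hτ n).2 _ (hz n)).2.1) hunif
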